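/- **Theorem (Bergman kernel of $\mathcal{H}_k$).** Let $n, k \ge 1$ be integers and let $$\mathcal{H}_k = \{(z,w) \in \mathbb{C}^{1+n} : |w_1|^2 + \cdots + |w_n|^2 < |z|^{2k} < 1\}.$$ Let $L^2_a(\mathcal{H}_k)$ be the space of holomorphic functions on $\mathcal{H}_k$ that are square integrable with respect to Lebesgue measure $dV$, and let $\mathbf{P} : L^2(\mathcal{H}_k) \to L^2_a(\mathcal{H}_k)$ be the orthogonal projection. The Bergman kernel of $\mathcal{H}_k$ is the function $K_{\mathcal{H}_k}$ on $\mathcal{H}_k \times \mathcal{H}_k$ such that $\overline{K_{\mathcal{H}_k}(p,\cdot)} \in L^2_a(\mathcal{H}_k)$ for every $p \in \mathcal{H}_k$ and $$\mathbf{P}f(p) = \int_{\mathcal{H}_k} K_{\mathcal{H}_k}(p,q) f(q)\, dV(q) \qquad \text{for all } f \in L^2(\mathcal{H}_k),\ p \in \mathcal{H}_k.$$ This kernel exists, is unique, and is given for all $(z,w), (x,y) \in \mathcal{H}_k$ by $$K_{\mathcal{H}_k}((z,w),(x,y)) = \frac{n!\, \eta^{k}}{\pi^{n+1} (1-\eta)^2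 (\eta^{k} - \nu_1 - \cdots - \nu_n)^{n+1}},$$ where $\eta = z\overline{x}$ and $\nu_j = w_j \overline{y}_j$ for $j = 1, \dots, n$. -/

import Mathlib

open MeasureTheory
open scoped Nat ComplexConjugate

/-- The Bergman space `L²_a(Ω)`: the subspace of `L²(Ω)` (with respect to Lebesgue measure on `Ω`)
of all classes that have a representative holomorphic on `Ω`. -/
def bergmanSpace {E : Type*} [NormedAddCommGroup E] [NormedSpace ℂ E] [MeasureSpace E]
    (Ω : Set E) : Submodule ℂ (Lp ℂ 2 (volume.restrict Ω)) where
  carrier := {f | ∃ g : E → ℂ, DifferentiableOn ℂ g Ω ∧ f =ᵐ[volume.restrict Ω] g}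
  zero_mem' := ⟨0, differentiableOn_const (0 : ℂ), Lp.coeFn_zero ℂ 2 (volume.restrict Ω)⟩
  add_mem' := by
    rintro f₁ f₂ ⟨g₁, hg₁, h₁⟩ ⟨g₂, hg₂, h₂⟩
    exact ⟨g₁ + g₂, hg₁.add hg₂, (Lp.coeFn_add f₁ f₂).trans (h₁.add h₂)⟩
  smul_mem' := by
    rintro c f ⟨g, hg, h⟩
    exact ⟨c • g, hg.const_smul c, (Lp.coeFn_smul c f).trans (h.const_smul c)⟩

/-- `g` is the image `P f` of `f ∈ L²(Ω)` under the Bergman projection, that is, the orthogonal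
projection of `L²(Ω)` onto `L²_a(Ω)`; `P f` is taken as a genuine holomorphic function on `Ω`
and not only as a class modulo null sets. -/
def IsBergmanProjection {E : Type*} [NormedAddCommGroup E] [NormedSpace ℂ E] [MeasureSpace E]
    (Ω : Set E) (f : Lp ℂ 2 (volume.restrict Ω)) (g : E → ℂ) : Prop :=
  DifferentiableOn ℂ g Ω ∧
    ∃ g' ∈ bergmanSpace Ω, g' =ᵐ[volume.restrict Ω] g ∧ f - g' ∈ (bergmanSpace Ω)ᗮ

/-- `K` is the Bergman kernel of `Ω`: for every `p ∈ Ω` the function `q ↦ conj (K p q)` is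
holomorphic and square integrable on `Ω` (it is the element of `L²_a(Ω)` that the Riesz
representation theorem yields for evaluation at `p`), and the Bergman projection is the integral
operator with kernel `K`, i.e. `P f (p) = ∫_Ω K(p, q) f(q) dV(q)` for all `f ∈ L²(Ω)`, `p ∈ Ω`. -/
structure IsBergmanKernel {E : Type*} [NormedAddCommGroup E] [NormedSpace ℂ E] [MeasureSpace E]
    (Ω : Set E) (K : E → E → ℂ) : Prop where
  differentiableOn_conj : ∀ p ∈ Ω, DifferentiableOn ℂ (fun q => conj (K p q)) Ω
  memLp : ∀ p ∈ Ω, MemLp (K p) 2 (volume.restrict Ω)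
  projection : ∀ f : Lp ℂ 2 (volume.restrict Ω),
    IsBergmanProjection Ω f (fun p => ∫ q in Ω, K p q * f q)

/-- The generalized Hartogs triangle
`{(z, w) ∈ ℂ × ℂⁿ : |w₁|² + ⋯ + |wₙ|² < |z|^{2k} < 1}`. -/
def hartogsTriangle (n k : ℕ) : Set (ℂ × (Fin n → ℂ)) :=
  {p | ∑ j, ‖p.2 j‖ ^ 2 < ‖p.1‖ ^ (2 * k) ∧ ‖p.1‖ ^ (2 * k) < 1}

/-!
The Bergman kernel of the Hartogs triangle
`{(z, w) ∈ ℂ × ℂⁿ : |w₁|² + ⋯ + |wₙ|² < |z|^{2k} < 1}`.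

Over a fixed `x` in the punctured unit disc the slice of the domain is the ball of radius `|x|^k`.
For fixed `(z, w)`, the explicit kernel restricted to this slice is a multiple of the Bergman kernel
of that ball at the point `a(x) = (x/z)^k w`. Integrating a function `h` in the Bergman space
against it over the slice therefore gives `f(x) / (π z^{kn} (1 - z x̄)²)` with
`f(x) = x^{kn} h(x, a(x))`. The function `f` is holomorphic and square integrable on the punctured
disc, so it extends to the disc, and the Bergman kernel `1 / (π (1 - z x̄)²)` of the disc returns
`f(z) / z^{kn} = h(z, w)`. This is the reproducing property `setIntegral_hartogsKernel_mul`.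

The reproducing property of the ball (`setIntegral_sqBall_kernel`) is reduced by a unitary change
of coordinates to a point `(r, 0, …, 0)`. The kernel then depends on the first coordinate only, the
mean value property (`setIntegral_sqBall_eq`) integrates out the other coordinates, and a weighted
integral over a disc remains. That integral (`setIntegral_disc_weighted`), which with trivial weight
is also the reproducing property of the disc, is computed in polar coordinates: on the circle of
radius `ρ` one has `ζ̄ = ρ² / ζ`, so the angular integral is a contour integral, its contour can be
moved to a circle independent of `ρ`, the radial integral has an elementary antiderivative, and
Cauchy's integral formula finishes the computation.

From the reproducing property the rest is soft. The kernel is bounded by a locally bounded function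
of `p = (z, w)` times `|x|^{-kn}`, which is square integrable, so `p ↦ ∫ K(p, q) f(q) dV(q)` is
holomorphic for every `f ∈ L²`. Since this function agrees with `f` for `f` in the Bergman space,
and point evaluations of it are continuous in `f`, the Bergman space is closed. The orthogonal
projection hence exists, and the integral operator vanishes on the orthogonal complement and is the
identity on the Bergman space. Uniqueness (`IsBergmanKernel.eqOn`) holds on every open set.
-/

/-! ### Balls in `ℂⁿ` and the mean value property -/

/-- The open Euclidean ball of `ℂⁿ` about the origin, parametrized by the square `t` of its radius
(the norm of `Fin n → ℂ` is the sup norm). It is empty for `t ≤ 0`. -/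
def sqBall (n : ℕ) (t : ℝ) : Set (Fin n → ℂ) := {u | ∑ j, ‖u j‖ ^ 2 < t}

lemma isOpen_sqBall (n : ℕ) (t : ℝ) : IsOpen (sqBall n t) :=
  isOpen_lt (by fun_prop) continuous_const

lemma measurableSet_sqBall (n : ℕ) (t : ℝ) : MeasurableSet (sqBall n t) :=
  (isOpen_sqBall n t).measurableSet

lemma volume_sqBall (n : ℕ) {t : ℝ} (ht : 0 < t) :
    volume (sqBall n t) = ENNReal.ofReal ((Real.pi * t) ^ n / n !) := by
  -- In dimension zero the ball is a point of mass one; the general formula needs `0 < n`.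
  rcases n.eq_zero_or_pos with rfl | hn
  · have : sqBall 0 t = {default} := by
      ext u
      simp [sqBall, ht, eq_iff_true_of_subsingleton]
    rw [this, volume_pi, Measure.pi_of_empty _ default]
    simp
  have : Nonempty (Fin n) := ⟨⟨0, hn⟩⟩
  have h := Complex.volume_sum_rpow_lt (Fin n) (p := 2) (by norm_num) (Real.sqrt t)
  have hset : {x : Fin n → ℂ | (∑ i, ‖x i‖ ^ (2 : ℝ)) ^ (1 / (2 : ℝ)) < Real.sqrt t} =
      sqBall n t := by
    ext u
    simp only [sqBall, Set.mem_ofPred_eq, Real.rpow_two]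
    rw [← Real.sqrt_eq_rpow]
    exact Real.sqrt_lt_sqrt_iff (by positivity)
  rw [hset] at h
  rw [h, Fintype.card_fin, ← ENNReal.ofReal_pow (Real.sqrt_nonneg _),
    ← ENNReal.ofReal_mul (by positivity)]
  congr 1
  rw [pow_mul, Real.sq_sqrt ht.le, show (2 : ℝ) * n / 2 + 1 = (n : ℝ) + 1 by ring,
    Real.Gamma_nat_eq_factorial, show (2 : ℝ) / 2 + 1 = ((1 : ℕ) : ℝ) + 1 by norm_num,
    Real.Gamma_nat_eq_factorial, mul_pow, mul_pow]
  simp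
  ring

lemma volume_real_sqBall (n : ℕ) {t : ℝ} (ht : 0 < t) :
    volume.real (sqBall n t) = (Real.pi * t) ^ n / n ! := by
  rw [Measure.real, volume_sqBall n ht, ENNReal.toReal_ofReal (by positivity)]

lemma sqBall_eq_empty (n : ℕ) {t : ℝ} (ht : t ≤ 0) : sqBall n t = ∅ := by
  ext u
  simp only [sqBall, Set.mem_ofPred_eq, Set.mem_empty_iff_false, iff_false, not_lt]
  exact ht.trans (by positivity)

lemma volume_sqBall_lt_top (n : ℕ) (t : ℝ) : volume (sqBall n t) < ⊤ := by
  rcases le_or_gt t 0 with ht | ht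
  · simp [sqBall_eq_empty n ht]
  · simp [volume_sqBall n ht]

/-- A linear isometry for the Euclidean norm preserves the volume: it multiplies volumes by a
constant, and it maps the unit ball to itself. -/
lemma measurePreserving_of_sum_norm_sq {n : ℕ} (U : (Fin n → ℂ) ≃ₗ[ℂ] (Fin n → ℂ))
    (hU : ∀ u, ∑ j, ‖U u j‖ ^ 2 = ∑ j, ‖u j‖ ^ 2) :
    MeasurePreserving U volume volume := by
  have hcont : Continuous U := U.toLinearMap.continuous_of_finiteDimensional
  refine ⟨hcont.measurable, ?_⟩
  set V : (Fin n → ℂ) →ₗ[ℝ] (Fin n → ℂ) := U.toLinearMap.restrictScalars ℝ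
  have hdet : LinearMap.det V ≠ 0 := by
    have : V = ((U.restrictScalars ℝ : (Fin n → ℂ) ≃ₗ[ℝ] (Fin n → ℂ)) :
      (Fin n → ℂ) →ₗ[ℝ] (Fin n → ℂ)) := rfl
    rw [this]
    exact (LinearEquiv.isUnit_det' _).ne_zero
  have h := Measure.map_linearMap_addHaar_eq_smul_addHaar (μ := volume) (f := V) hdet
  have hVU : (V : (Fin n → ℂ) → (Fin n → ℂ)) = U := rfl
  rw [hVU] at h
  have hB := congrArg (fun μ => μ (sqBall n 1)) h
  have hpre : U ⁻¹' sqBall n 1 = sqBall n 1 := by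
    ext u; simp [sqBall, hU]
  simp only [Measure.map_apply hcont.measurable (measurableSet_sqBall n 1), hpre,
    Measure.smul_apply, smul_eq_mul] at hB
  have h0 : volume (sqBall n 1) ≠ 0 := by
    rw [volume_sqBall n one_pos]
    simp only [mul_one, ne_eq, ENNReal.ofReal_eq_zero, not_le]
    positivity
  have hc : ENNReal.ofReal |(LinearMap.det V)⁻¹| = 1 := by
    have := (ENNReal.mul_left_inj h0 (volume_sqBall_lt_top n 1).ne).1
      ((one_mul _).trans hB)
    exact this.symm
  rw [h, hc, one_smul]

/-- The mean value property over balls, obtained by averaging over the rotations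
`u ↦ e^{iθ} u`. -/
lemma setIntegral_sqBall_eq {n : ℕ} {t : ℝ} (ht : 0 < t) {H : (Fin n → ℂ) → ℂ}
    (hH : DifferentiableOn ℂ H (sqBall n t)) (hi : IntegrableOn H (sqBall n t)) :
    ∫ u in sqBall n t, H u = ((Real.pi : ℂ) * t) ^ n / n ! * H 0 := by
  set c : ℝ → ℂ := fun θ => circleMap 0 1 θ with hcdef
  have hc : ∀ θ, ‖c θ‖ = 1 := fun θ => by simp [c]
  have hc0 : ∀ θ, c θ ≠ 0 := fun θ => norm_ne_zero_iff.1 (by simp [hc])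
  have hmp : ∀ θ, MeasurePreserving (fun u : Fin n → ℂ => c θ • u) volume volume := by
    intro θ
    refine measurePreserving_of_sum_norm_sq (LinearEquiv.smulOfNeZero ℂ _ (c θ) (hc0 θ)) ?_
    intro u
    simp [hc]
  have hpre : ∀ θ, (fun u : Fin n → ℂ => c θ • u) ⁻¹' sqBall n t = sqBall n t := by
    intro θ; ext u; simp [sqBall, hc]
  have hemb : ∀ θ, MeasurableEmbedding (fun u : Fin n → ℂ => c θ • u) := fun θ =>
    (Homeomorph.smulOfNeZero (c θ) (hc0 θ)).measurableEmbedding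
  have h1 : ∀ θ, ∫ u in sqBall n t, H (c θ • u) = ∫ u in sqBall n t, H u := by
    intro θ
    have := (hmp θ).setIntegral_preimage_emb (hemb θ) H (sqBall n t)
    rwa [hpre] at this
  have hccont : Continuous c := continuous_circleMap 0 1
  have h2 : ∀ u ∈ sqBall n t, ∫ θ in Set.Ioc 0 (2 * Real.pi), H (c θ • u) = 2 * Real.pi * H 0 := by
    intro u hu
    have hmaps : ∀ l : ℂ, ‖l‖ ≤ 1 → l • u ∈ sqBall n t := by
      intro l hl
      simp only [sqBall, Set.mem_ofPred_eq, Pi.smul_apply, smul_eq_mul, norm_mul, mul_pow] at hu ⊢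
      rw [← Finset.mul_sum]
      refine lt_of_le_of_lt ?_ hu
      exact mul_le_of_le_one_left (by positivity) (pow_le_one₀ (norm_nonneg _) hl)
    have hd : DifferentiableOn ℂ (fun l : ℂ => H (l • u)) (Metric.closedBall 0 1) := by
      refine hH.comp (f := fun l : ℂ => l • u) (by fun_prop) ?_
      intro l hl
      exact hmaps l (by simpa using hl)
    have hm := DiffContOnCl.circleAverage (f := fun l : ℂ => H (l • u)) (c := 0) (R := 1)
      (by rw [abs_one]; exact hd.diffContOnCl_ball subset_rfl)
    rw [Real.circleAverage_def, intervalIntegral.integral_of_le (by positivity)] at hm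
    simp only [zero_smul] at hm
    rw [← hm, Complex.real_smul]
    push_cast
    field_simp
    rfl
  have hskew : MeasurePreserving (fun p : ℝ × (Fin n → ℂ) => (p.1, c p.1 • p.2))
      ((volume.restrict (Set.Ioc 0 (2 * Real.pi))).prod (volume.restrict (sqBall n t)))
      ((volume.restrict (Set.Ioc 0 (2 * Real.pi))).prod (volume.restrict (sqBall n t))) := by
    refine (MeasurePreserving.id _).skew_product (g := fun θ u => c θ • u) ?_ ?_
    · exact ((hccont.comp continuous_fst).smul continuous_snd).measurable
    · refine Filter.Eventually.of_forall fun θ => ?_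
      have := (hmp θ).restrict_preimage (measurableSet_sqBall n t)
      rw [hpre] at this
      exact this.map_eq
  have hprod : Integrable (fun p : ℝ × (Fin n → ℂ) => H (c p.1 • p.2))
      ((volume.restrict (Set.Ioc 0 (2 * Real.pi))).prod (volume.restrict (sqBall n t))) := by
    have h3 : Integrable (fun p : ℝ × (Fin n → ℂ) => H p.2)
      ((volume.restrict (Set.Ioc 0 (2 * Real.pi))).prod (volume.restrict (sqBall n t))) :=
      Integrable.comp_snd hi _
    exact hskew.integrable_comp_of_integrable h3
  have hswap := integral_integral_swap (f := fun θ u => H (c θ • u)) hprod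
  simp only [h1] at hswap
  rw [setIntegral_congr_fun (measurableSet_sqBall n t) h2] at hswap
  simp only [integral_const, MeasurableSet.univ, measureReal_restrict_apply, Set.univ_inter,
    volume_real_sqBall n ht, Real.volume_real_Ioc, Complex.real_smul] at hswap
  have hpi : max (2 * Real.pi - 0) 0 = 2 * Real.pi := by
    rw [sub_zero]; exact max_eq_left (by positivity)
  rw [hpi] at hswap
  have hpi0 : (2 * (Real.pi : ℂ)) ≠ 0 := by simp [Real.pi_ne_zero]
  apply mul_left_cancel₀ hpi0
  push_cast at hswap
  rw [hswap]
  ring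

/-! ### Weighted integrals over a disc -/

lemma polarCoord_symm_eq_circleMap (p : ℝ × ℝ) :
    Complex.polarCoord.symm p = circleMap 0 p.1 p.2 := by
  rw [Complex.polarCoord_symm_apply, circleMap, zero_add, Complex.exp_mul_I]
  push_cast
  rfl

/-- Integration over a disc in polar coordinates, as an iterated integral. -/
lemma setIntegral_ball_eq_polar {s : ℝ} {G : ℂ → ℂ}
    (hc : ContinuousOn G (Metric.ball 0 s)) (hi : IntegrableOn G (Metric.ball 0 s)) :
    ∫ ζ in Metric.ball 0 s, G ζ =
      ∫ ρ in Set.Ioo 0 s, ∫ θ in Set.Ioo (-Real.pi) Real.pi, (ρ : ℂ) * G (circleMap 0 ρ θ) := by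
  set S : Set (ℝ × ℝ) := Set.Ioo 0 s ×ˢ Set.Ioo (-Real.pi) Real.pi with hS
  have hSm : MeasurableSet S := measurableSet_Ioo.prod measurableSet_Ioo
  have hST : S ⊆ polarCoord.target := by
    rw [polarCoord_target]
    exact Set.prod_mono (fun x hx => hx.1) subset_rfl
  have hmem : ∀ p ∈ polarCoord.target, (circleMap 0 p.1 p.2 ∈ Metric.ball (0 : ℂ) s ↔ p ∈ S) := by
    intro p hp
    rw [polarCoord_target] at hp
    have h1 : 0 < p.1 := hp.1
    simp only [mem_ball_zero_iff, norm_circleMap_zero, abs_of_pos h1, hS, Set.mem_prod,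
      Set.mem_Ioo, h1, true_and]
    exact ⟨fun h => ⟨h, hp.2⟩, fun h => h.1⟩
  have key : ∫ ζ in Metric.ball 0 s, G ζ =
      ∫ p in S, (p.1 : ℂ) * G (circleMap 0 p.1 p.2) := by
    rw [← integral_indicator Metric.isOpen_ball.measurableSet,
      ← Complex.integral_comp_polarCoord_symm, ← Set.inter_eq_self_of_subset_right hST,
      ← setIntegral_indicator hSm]
    refine setIntegral_congr_fun polarCoord.open_target.measurableSet fun p hp => ?_
    simp only [polarCoord_symm_eq_circleMap]
    by_cases h : p ∈ S
    · rw [Set.indicator_of_mem h, Set.indicator_of_mem ((hmem p hp).2 h), Complex.real_smul]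
    · rw [Set.indicator_of_notMem h, Set.indicator_of_notMem (fun h' => h ((hmem p hp).1 h')),
        smul_zero]
  have hint : IntegrableOn (fun p : ℝ × ℝ => (p.1 : ℂ) * G (circleMap 0 p.1 p.2)) S := by
    constructor
    · refine ContinuousOn.aestronglyMeasurable ?_ hSm
      refine ContinuousOn.mul (by fun_prop) (hc.comp (f := fun p : ℝ × ℝ => circleMap 0 p.1 p.2)
        ?_ fun p hp => (hmem p (hST hp)).2 hp)
      unfold circleMap
      fun_prop
    · have h1 := Complex.lintegral_comp_polarCoord_symm
        ((Metric.ball (0 : ℂ) s).indicator fun z => ‖G z‖ₑ)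
      rw [lintegral_indicator Metric.isOpen_ball.measurableSet] at h1
      have h2 : (∫⁻ z in Metric.ball (0 : ℂ) s, ‖G z‖ₑ) < ⊤ := hi.2
      rw [← h1] at h2
      refine lt_of_le_of_lt ?_ h2
      rw [← Set.inter_eq_self_of_subset_left hST, ← setLIntegral_indicator hSm]
      refine setLIntegral_mono' polarCoord.open_target.measurableSet fun p hp => ?_
      simp only [polarCoord_symm_eq_circleMap]
      by_cases h : p ∈ S
      · rw [Set.indicator_of_mem h, Set.indicator_of_mem ((hmem p hp).2 h), enorm_mul, smul_eq_mul]
        gcongr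
        rw [← ofReal_norm, Complex.norm_real, Real.norm_eq_abs, abs_of_pos]
        exact h.1.1
      · rw [Set.indicator_of_notMem h]
        simp
  rw [key, hS, Measure.volume_eq_prod, setIntegral_prod]
  rw [← Measure.volume_eq_prod]
  exact hint

/-- The angular part of a weighted disc integral as a contour integral over a circle whose radius
`R` does not depend on `ρ`. -/
lemma integral_circle_eq {s R ρ : ℝ} {r : ℂ} {F : ℂ → ℂ} (m : ℕ) (hρ : 0 < ρ) (hρs : ρ < s)
    (hrR : ‖r‖ < R) (hRs : R < s) (hF : DifferentiableOn ℂ F (Metric.ball 0 s)) :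
    ∫ θ in Set.Ioo (-Real.pi) Real.pi, F (circleMap 0 ρ θ) /
        ((s : ℂ) ^ 2 - r * conj (circleMap 0 ρ θ)) ^ (m + 2) =
      -Complex.I * ∮ ζ in C(0, R), F ζ * ζ ^ (m + 1) / ((s : ℂ) ^ 2 * ζ - r * ρ ^ 2) ^ (m + 2) := by
  have hR : 0 < R := (norm_nonneg r).trans_lt hrR
  have hs : 0 < s := hR.trans hRs
  -- The pole of the integrand lies inside both circles.
  have hne : ∀ ζ : ℂ, min ρ R ≤ ‖ζ‖ → (s : ℂ) ^ 2 * ζ - r * ρ ^ 2 ≠ 0 := by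
    intro ζ hζ h0
    have h1 : s ^ 2 * ‖ζ‖ = ‖r‖ * ρ ^ 2 := by
      have := congrArg norm (sub_eq_zero.1 h0)
      simpa [abs_of_pos hs, abs_of_pos hρ] using this
    rcases min_choice ρ R with h | h <;> rw [h] at hζ
    · nlinarith [mul_lt_mul'' (hrR.trans hRs) hρs (norm_nonneg _) hρ.le, mul_pos hs hρ,
        mul_le_mul_of_nonneg_left hζ (sq_nonneg s)]
    · have : ‖r‖ * ρ ^ 2 ≤ ‖r‖ * s ^ 2 := by gcongr
      nlinarith [mul_lt_mul_of_pos_left (hrR.trans_le hζ) (pow_pos hs 2)]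
  set Φ : ℂ → ℂ := fun ζ => F ζ * ζ ^ (m + 1) / ((s : ℂ) ^ 2 * ζ - r * ρ ^ 2) ^ (m + 2) with hΦ
  have hd : ∀ ζ : ℂ, min ρ R ≤ ‖ζ‖ → ‖ζ‖ < s → DifferentiableAt ℂ Φ ζ := by
    intro ζ h1 h2
    have hFd : DifferentiableAt ℂ F ζ :=
      hF.differentiableAt (Metric.isOpen_ball.mem_nhds (by simpa using h2))
    exact (hFd.mul (by fun_prop)).div (by fun_prop) (pow_ne_zero _ (hne ζ h1))
  have hcircle : (∮ ζ in C(0, R), Φ ζ) = ∮ ζ in C(0, ρ), Φ ζ := by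
    rcases le_total ρ R with h | h
    · refine Complex.circleIntegral_eq_of_differentiable_on_annulus_off_countable hρ h
        Set.countable_empty ?_ ?_
      · intro ζ hζ
        simp only [Set.mem_sdiff, Metric.mem_closedBall, dist_zero_right, Metric.mem_ball,
          not_lt] at hζ
        exact (hd ζ (min_le_of_left_le hζ.2) (hζ.1.trans_lt hRs)).continuousAt.continuousWithinAt
      · intro ζ hζ
        simp only [Set.mem_sdiff, Metric.mem_closedBall, dist_zero_right, Metric.mem_ball,
          not_le] at hζ
        exact hd ζ (min_le_of_left_le hζ.1.2.le) (hζ.1.1.trans hRs)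
    · refine (Complex.circleIntegral_eq_of_differentiable_on_annulus_off_countable hR h
        Set.countable_empty ?_ ?_).symm
      · intro ζ hζ
        simp only [Set.mem_sdiff, Metric.mem_closedBall, dist_zero_right, Metric.mem_ball,
          not_lt] at hζ
        exact (hd ζ (min_le_of_right_le hζ.2) (hζ.1.trans_lt hρs)).continuousAt.continuousWithinAt
      · intro ζ hζ
        simp only [Set.mem_sdiff, Metric.mem_closedBall, dist_zero_right, Metric.mem_ball,
          not_le] at hζ
        exact hd ζ (min_le_of_right_le hζ.1.2.le) (hζ.1.1.trans hρs)
  rw [hcircle, circleIntegral]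
  have hper : Function.Periodic (fun θ => deriv (circleMap 0 ρ) θ • Φ (circleMap 0 ρ θ))
      (2 * Real.pi) := by
    intro θ
    simp only [deriv_circleMap, periodic_circleMap 0 ρ θ]
  have h2 := hper.intervalIntegral_add_eq 0 (-Real.pi)
  rw [zero_add, show -Real.pi + 2 * Real.pi = Real.pi by ring] at h2
  rw [h2, intervalIntegral.integral_of_le (by linarith [Real.pi_pos]), integral_Ioc_eq_integral_Ioo,
    ← integral_const_mul]
  refine setIntegral_congr_fun measurableSet_Ioo fun θ _ => ?_
  have hn : ‖circleMap 0 ρ θ‖ = ρ := by simp [abs_of_pos hρ]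
  have hζ0 : circleMap 0 ρ θ ≠ 0 := norm_ne_zero_iff.1 (by rw [hn]; exact hρ.ne')
  simp only [deriv_circleMap, hΦ, smul_eq_mul]
  have h3 := hne _ ((min_le_left ρ R).trans hn.ge)
  generalize circleMap 0 ρ θ = ζ at *
  -- On the circle of radius `ρ` the conjugate of `ζ` is `ρ ^ 2 / ζ`.
  have h4 : conj ζ = (ρ : ℂ) ^ 2 / ζ := by
    rw [eq_div_iff hζ0, ← hn, mul_comm, Complex.mul_conj']
  have h5 : (s : ℂ) ^ 2 - r * conj ζ = ((s : ℂ) ^ 2 * ζ - r * ρ ^ 2) / ζ := by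
    rw [h4]; field_simp
  rw [h5, div_pow, div_div_eq_mul_div]
  linear_combination (F ζ * ζ ^ (m + 2) / ((s : ℂ) ^ 2 * ζ - r * ρ ^ 2) ^ (m + 2)) * Complex.I_sq

/-- The radial part of a weighted disc integral; the antiderivative is a multiple of
`((s² - ρ²) / (s² ζ - r ρ²))^(m + 1)`. -/
lemma integral_radial_eq {s : ℝ} {r ζ : ℂ} (m : ℕ) (hs : 0 < s) (hr : ‖r‖ < ‖ζ‖) :
    ∫ ρ in (0 : ℝ)..s, (ρ : ℂ) * ((s : ℂ) ^ 2 - ρ ^ 2) ^ m /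
        ((s : ℂ) ^ 2 * ζ - r * ρ ^ 2) ^ (m + 2) =
      1 / (2 * (m + 1) * (s : ℂ) ^ 2 * (ζ - r) * ζ ^ (m + 1)) := by
  have hne : ∀ ρ ∈ Set.uIcc 0 s, (s : ℂ) ^ 2 * ζ - r * (ρ : ℂ) ^ 2 ≠ 0 := by
    intro ρ hρ h0
    rw [Set.uIcc_of_le hs.le] at hρ
    have h1 : s ^ 2 * ‖ζ‖ = ‖r‖ * ρ ^ 2 := by
      have := congrArg norm (sub_eq_zero.1 h0)
      simpa [abs_of_pos hs, abs_of_nonneg hρ.1] using this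
    have : ‖r‖ * ρ ^ 2 ≤ ‖r‖ * s ^ 2 := by
      have := hρ.1; have := hρ.2
      gcongr
    nlinarith [mul_lt_mul_of_pos_left hr (pow_pos hs 2)]
  have hs0 : (s : ℂ) ≠ 0 := by exact_mod_cast hs.ne'
  have hζ0 : ζ ≠ 0 := norm_pos_iff.1 ((norm_nonneg r).trans_lt hr)
  have hζr : ζ - r ≠ 0 := by
    intro h; rw [sub_eq_zero] at h; rw [h] at hr; exact lt_irrefl _ hr
  have hm : ((m : ℂ) + 1) ≠ 0 := by exact_mod_cast m.succ_ne_zero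
  set c : ℂ := -(1 / (2 * (m + 1) * (s : ℂ) ^ 2 * (ζ - r))) with hcdef
  have hderiv : ∀ ρ ∈ Set.uIcc 0 s, HasDerivAt
      (fun ρ : ℝ => c * (((s : ℂ) ^ 2 - (ρ : ℂ) ^ 2) /
        ((s : ℂ) ^ 2 * ζ - r * (ρ : ℂ) ^ 2)) ^ (m + 1))
      ((ρ : ℂ) * ((s : ℂ) ^ 2 - ρ ^ 2) ^ m / ((s : ℂ) ^ 2 * ζ - r * ρ ^ 2) ^ (m + 2)) ρ := by
    intro ρ hρ
    have hn := hne ρ hρ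
    have h1 : HasDerivAt (fun ρ : ℝ => (ρ : ℂ) ^ 2) (2 * (ρ : ℂ)) ρ := by
      simpa using ((hasDerivAt_id ρ).ofReal_comp).fun_pow 2
    have h2 := (((h1.const_sub ((s : ℂ) ^ 2)).div ((h1.const_mul r).const_sub ((s : ℂ) ^ 2 * ζ))
      hn).pow (m + 1)).const_mul c
    refine h2.congr_deriv ?_
    simp only [Nat.add_sub_cancel, hcdef, Pi.div_apply, div_pow]
    push_cast
    field_simp
    ring
  rw [intervalIntegral.integral_eq_sub_of_hasDerivAt hderiv]
  · simp only [hcdef, sub_self, zero_div, Complex.ofReal_zero]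
    rw [zero_pow two_ne_zero, mul_zero, sub_zero, sub_zero,
      div_mul_cancel_left₀ (pow_ne_zero 2 hs0), zero_pow m.succ_ne_zero, inv_pow]
    field_simp
    simp
  · refine ContinuousOn.intervalIntegrable ?_
    refine ContinuousOn.div (by fun_prop) (by fun_prop) fun ρ hρ => pow_ne_zero _ (hne ρ hρ)

/-- The reproducing property of the weighted Bergman kernel of the disc of radius `s` with weight
`(s² - |ζ|²)^m`. -/
lemma setIntegral_disc_weighted {s : ℝ} {r : ℂ} {F : ℂ → ℂ} (m : ℕ) (hr : ‖r‖ < s)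
    (hF : DifferentiableOn ℂ F (Metric.ball 0 s))
    (hi : IntegrableOn (fun ζ => F ζ * ((s : ℂ) ^ 2 - ‖ζ‖ ^ 2) ^ m /
      ((s : ℂ) ^ 2 - r * conj ζ) ^ (m + 2)) (Metric.ball 0 s)) :
    ∫ ζ in Metric.ball 0 s, F ζ * ((s : ℂ) ^ 2 - ‖ζ‖ ^ 2) ^ m /
      ((s : ℂ) ^ 2 - r * conj ζ) ^ (m + 2) = Real.pi / ((m + 1) * (s : ℂ) ^ 2) * F r := by
  have hs : 0 < s := (norm_nonneg r).trans_lt hr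
  have hs0 : (s : ℂ) ≠ 0 := by exact_mod_cast hs.ne'
  have hm : ((m : ℂ) + 1) ≠ 0 := by exact_mod_cast m.succ_ne_zero
  obtain ⟨R, hrR, hRs⟩ := exists_between hr
  have hR : 0 < R := (norm_nonneg r).trans_lt hrR
  rw [setIntegral_ball_eq_polar _ hi]
  swap
  · refine ContinuousOn.div (hF.continuousOn.mul (by fun_prop)) (by fun_prop) fun ζ hζ => ?_
    refine pow_ne_zero _ fun h0 => ?_
    have h1 : s ^ 2 = ‖r‖ * ‖ζ‖ := by
      have := congrArg norm (sub_eq_zero.1 h0)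
      simpa [abs_of_pos hs] using this
    have h2 : ‖ζ‖ < s := by simpa using hζ
    nlinarith [mul_lt_mul'' hr h2 (norm_nonneg _) (norm_nonneg _)]
  have h1 : ∀ ρ ∈ Set.Ioo 0 s, ∫ θ in Set.Ioo (-Real.pi) Real.pi, (ρ : ℂ) *
      (F (circleMap 0 ρ θ) * ((s : ℂ) ^ 2 - ‖circleMap 0 ρ θ‖ ^ 2) ^ m /
      ((s : ℂ) ^ 2 - r * conj (circleMap 0 ρ θ)) ^ (m + 2)) =
      ∫ θ in (0 : ℝ)..(2 * Real.pi), -Complex.I * (deriv (circleMap 0 R) θ *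
        (F (circleMap 0 R θ) * circleMap 0 R θ ^ (m + 1))) * ((ρ : ℂ) * ((s : ℂ) ^ 2 - ρ ^ 2) ^ m /
        ((s : ℂ) ^ 2 * circleMap 0 R θ - r * ρ ^ 2) ^ (m + 2)) := by
    intro ρ hρ
    have h := integral_circle_eq m hρ.1 hρ.2 hrR hRs hF
    rw [circleIntegral] at h
    have e1 : ∀ θ, (ρ : ℂ) *
      (F (circleMap 0 ρ θ) * ((s : ℂ) ^ 2 - ‖circleMap 0 ρ θ‖ ^ 2) ^ m /
      ((s : ℂ) ^ 2 - r * conj (circleMap 0 ρ θ)) ^ (m + 2)) =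
      ((ρ : ℂ) * ((s : ℂ) ^ 2 - ρ ^ 2) ^ m) * (F (circleMap 0 ρ θ) /
        ((s : ℂ) ^ 2 - r * conj (circleMap 0 ρ θ)) ^ (m + 2)) := by
      intro θ
      rw [norm_circleMap_zero, abs_of_pos hρ.1]
      ring
    simp only [e1]
    rw [integral_const_mul, h, ← intervalIntegral.integral_const_mul,
      ← intervalIntegral.integral_const_mul]
    refine intervalIntegral.integral_congr fun θ _ => ?_
    simp only [smul_eq_mul]
    ring
  rw [setIntegral_congr_fun measurableSet_Ioo h1, ← integral_Ioc_eq_integral_Ioo,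
    ← intervalIntegral.integral_of_le hs.le]
  have hcont : ContinuousOn (Function.uncurry fun (ρ θ : ℝ) =>
      -Complex.I * (deriv (circleMap 0 R) θ *
        (F (circleMap 0 R θ) * circleMap 0 R θ ^ (m + 1))) * ((ρ : ℂ) * ((s : ℂ) ^ 2 - ρ ^ 2) ^ m /
        ((s : ℂ) ^ 2 * circleMap 0 R θ - r * ρ ^ 2) ^ (m + 2)))
      (Set.uIcc 0 s ×ˢ Set.uIcc 0 (2 * Real.pi)) := by
    have hcm : Continuous (circleMap 0 R) := continuous_circleMap 0 R
    have hFc : Continuous fun θ => F (circleMap 0 R θ) := by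
      refine hF.continuousOn.comp_continuous hcm fun θ => ?_
      simpa [abs_of_pos hR] using hRs
    refine ContinuousOn.mul ?_ (ContinuousOn.div (by fun_prop) (by fun_prop) ?_)
    · simp only [deriv_circleMap]
      exact (continuous_const.mul (((hcm.comp continuous_snd).mul continuous_const).mul
        ((hFc.comp continuous_snd).mul ((hcm.comp continuous_snd).pow (m + 1))))).continuousOn
    · rintro ⟨ρ, θ⟩ ⟨hρ, -⟩
      refine pow_ne_zero _ fun h0 => ?_
      rw [Set.uIcc_of_le hs.le] at hρ
      simp only at hρ h0
      have h1 : s ^ 2 * R = ‖r‖ * ρ ^ 2 := by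
        have := congrArg norm (sub_eq_zero.1 h0)
        simpa [abs_of_pos hs, abs_of_nonneg hρ.1, abs_of_pos hR] using this
      have : ‖r‖ * ρ ^ 2 ≤ ‖r‖ * s ^ 2 := by
        have := hρ.1; have := hρ.2
        gcongr
      nlinarith [mul_lt_mul_of_pos_left hrR (pow_pos hs 2)]
  rw [intervalIntegral_intervalIntegral_swap]
  swap
  · refine (hcont.integrableOn_compact (isCompact_uIcc.prod isCompact_uIcc)).mono_set
      (Set.prod_mono Set.uIoc_subset_uIcc Set.uIoc_subset_uIcc)
  have hC := DifferentiableOn.circleIntegral_sub_inv_smul (R := R) (c := 0) (w := r) (f := F)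
    (hF.mono (Metric.closedBall_subset_ball hRs)) (by simpa using hrR)
  rw [circleIntegral] at hC
  have h2 : ∀ θ : ℝ, ∫ ρ in (0 : ℝ)..s, -Complex.I * (deriv (circleMap 0 R) θ *
        (F (circleMap 0 R θ) * circleMap 0 R θ ^ (m + 1))) * ((ρ : ℂ) * ((s : ℂ) ^ 2 - ρ ^ 2) ^ m /
        ((s : ℂ) ^ 2 * circleMap 0 R θ - r * ρ ^ 2) ^ (m + 2)) =
      -Complex.I / (2 * (m + 1) * (s : ℂ) ^ 2) *
        (deriv (circleMap 0 R) θ • (circleMap 0 R θ - r)⁻¹ • F (circleMap 0 R θ)) := by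
    intro θ
    have hn : ‖circleMap 0 R θ‖ = R := by simp [abs_of_pos hR]
    have hζ0 : circleMap 0 R θ ≠ 0 := norm_ne_zero_iff.1 (by rw [hn]; exact hR.ne')
    have hζr : circleMap 0 R θ - r ≠ 0 := by
      intro h; rw [sub_eq_zero] at h; rw [h] at hn; exact hrR.ne hn
    rw [intervalIntegral.integral_const_mul, integral_radial_eq m hs (by rwa [hn])]
    simp only [smul_eq_mul]
    field_simp
  simp only [h2]
  rw [intervalIntegral.integral_const_mul, hC, smul_eq_mul]
  field_simp
  linear_combination (-(F r)) * Complex.I_sq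

/-! ### The Bergman kernel of the ball -/

/-- Fubini's theorem for a measurable subset of a product, in terms of its slices. -/
lemma fubini_slices {X Y E : Type*} [NormedAddCommGroup E] [NormedSpace ℝ E]
    [MeasureSpace X] [MeasureSpace Y] [SFinite (volume : Measure X)]
    [SFinite (volume : Measure Y)] {S : Set (X × Y)}
    (hS : MeasurableSet S) {g : X × Y → E} (hi : IntegrableOn g S) :
    (∀ᵐ x : X, IntegrableOn (fun y => g (x, y)) (Prod.mk x ⁻¹' S)) ∧
      Integrable (fun x => ∫ y in Prod.mk x ⁻¹' S, g (x, y)) ∧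
      ∫ p in S, g p = ∫ x, ∫ y in Prod.mk x ⁻¹' S, g (x, y) := by
  have h1 : Integrable (S.indicator g) (volume.prod volume) := by
    rw [← Measure.volume_eq_prod]
    exact hi.integrable_indicator hS
  have h2 : ∀ x y, S.indicator g (x, y) = (Prod.mk x ⁻¹' S).indicator (fun y => g (x, y)) y :=
    fun x y => rfl
  have h3 : ∀ x : X, MeasurableSet (Prod.mk x ⁻¹' S) := fun x => measurable_prodMk_left hS
  refine ⟨?_, ?_, ?_⟩
  · filter_upwards [h1.prod_right_ae] with x hx
    simp only [h2] at hx
    exact (integrable_indicator_iff (h3 x)).1 hx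
  · have := h1.integral_prod_left
    simp only [h2, integral_indicator (h3 _)] at this
    exact this
  · rw [← integral_indicator hS, Measure.volume_eq_prod, integral_prod _ h1]
    simp only [h2, integral_indicator (h3 _)]

lemma norm_sum_mul_conj_sq_le {n : ℕ} (a u : Fin n → ℂ) :
    ‖∑ j, a j * conj (u j)‖ ^ 2 ≤ (∑ j, ‖a j‖ ^ 2) * ∑ j, ‖u j‖ ^ 2 := by
  have h1 : ‖∑ j, a j * conj (u j)‖ ≤ ∑ j, ‖a j‖ * ‖u j‖ := by
    refine (norm_sum_le _ _).trans (le_of_eq ?_)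
    simp
  exact (pow_le_pow_left₀ (norm_nonneg _) h1 2).trans (Finset.sum_mul_sq_le_sq_mul_sq _ _ _)

lemma norm_sum_mul_conj_le {n : ℕ} {a u : Fin n → ℂ} {α β : ℝ} (hα : 0 ≤ α) (hβ : 0 ≤ β)
    (ha : ∑ j, ‖a j‖ ^ 2 ≤ α ^ 2) (hu : ∑ j, ‖u j‖ ^ 2 ≤ β ^ 2) :
    ‖∑ j, a j * conj (u j)‖ ≤ α * β := by
  refine (sq_le_sq₀ (norm_nonneg _) (by positivity)).1 ?_
  rw [mul_pow]
  exact (norm_sum_mul_conj_sq_le a u).trans (by gcongr)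

/-- Every point `a` is the image of a point `(r, 0, …, 0)` under a unitary map `U`. The last clause
is `⟨a, U u⟩ = ⟨(r, 0, …, 0), u⟩`. -/
lemma exists_linearEquiv_axis {m : ℕ} (a : Fin (m + 1) → ℂ) :
    ∃ (U : (Fin (m + 1) → ℂ) ≃ₗ[ℂ] (Fin (m + 1) → ℂ)) (r : ℂ),
      (∀ u, ∑ j, ‖U u j‖ ^ 2 = ∑ j, ‖u j‖ ^ 2) ∧ U (Fin.cons r 0) = a ∧
      ∀ u, ∑ j, a j * conj (U u j) = r * conj (u 0) := by
  obtain ⟨b, r, hb⟩ : ∃ (b : OrthonormalBasis (Fin (m + 1)) ℂ (EuclideanSpace ℂ (Fin (m + 1))))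
      (r : ℂ), WithLp.toLp 2 a = r • b 0 := by
    by_cases ha : WithLp.toLp 2 a = 0
    · exact ⟨EuclideanSpace.basisFun _ _, 0, by simp [ha]⟩
    · have hv : Orthonormal ℂ (({0} : Set (Fin (m + 1))).domRestrict
          fun _ => ((‖WithLp.toLp 2 a‖ : ℂ)⁻¹ • WithLp.toLp 2 a)) := by
        constructor
        · rintro ⟨i, hi⟩
          simp only [Set.domRestrict_apply, norm_smul, norm_inv, Complex.norm_real, norm_norm]
          exact inv_mul_cancel₀ (norm_ne_zero_iff.2 ha)
        · rintro ⟨i, hi⟩ ⟨j, hj⟩ hij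
          rw [Set.mem_singleton_iff] at hi hj
          exact absurd (Subtype.ext (hi.trans hj.symm)) hij
      obtain ⟨b, hb⟩ := hv.exists_orthonormalBasis_extension_of_card_eq (by simp)
      refine ⟨b, ‖WithLp.toLp 2 a‖, ?_⟩
      rw [hb 0 rfl, smul_inv_smul₀]
      exact_mod_cast norm_ne_zero_iff.2 ha
  let U : (Fin (m + 1) → ℂ) ≃ₗ[ℂ] (Fin (m + 1) → ℂ) :=
    ((WithLp.linearEquiv 2 ℂ (Fin (m + 1) → ℂ)).symm.trans b.repr.symm.toLinearEquiv).trans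
      (WithLp.linearEquiv 2 ℂ (Fin (m + 1) → ℂ))
  have hU : ∀ u, WithLp.toLp 2 (U u) = b.repr.symm (WithLp.toLp 2 u) := fun u => rfl
  refine ⟨U, r, fun u => ?_, ?_, fun u => ?_⟩
  · have h1 : ‖WithLp.toLp 2 (U u)‖ ^ 2 = ‖WithLp.toLp 2 u‖ ^ 2 := by
      rw [hU, LinearIsometryEquiv.norm_map]
    simpa [EuclideanSpace.norm_sq_eq] using h1
  · apply WithLp.toLp_injective 2
    rw [hU, hb, ← b.repr_symm_single 0, ← map_smul]
    congr 1
    ext i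
    refine Fin.cases ?_ (fun i => ?_) i <;> simp
  · have h1 : inner ℂ (WithLp.toLp 2 (U u)) (WithLp.toLp 2 a) = ∑ j, a j * conj (U u j) := by
      simp [PiLp.inner_apply]
    rw [← h1, hb, inner_smul_right, ← inner_conj_symm, ← b.repr_apply_apply, hU]
    simp

/-- The reproducing property of the Bergman kernel of the ball of radius `s` at a point of the first
coordinate axis. -/
lemma setIntegral_sqBall_kernel_axis {m : ℕ} {s : ℝ} {r : ℂ} (hr : ‖r‖ < s)
    {H : (Fin (m + 1) → ℂ) → ℂ} (hH : DifferentiableOn ℂ H (sqBall (m + 1) (s ^ 2)))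
    (hi : IntegrableOn (fun u => H u / ((s : ℂ) ^ 2 - r * conj (u 0)) ^ (m + 2))
      (sqBall (m + 1) (s ^ 2))) :
    ∫ u in sqBall (m + 1) (s ^ 2), H u / ((s : ℂ) ^ 2 - r * conj (u 0)) ^ (m + 2) =
      (Real.pi : ℂ) ^ (m + 1) / ((m + 1)! * (s : ℂ) ^ 2) * H (Fin.cons r 0) := by
  have hs : 0 < s := (norm_nonneg r).trans_lt hr
  have hs0 : (s : ℂ) ≠ 0 := by exact_mod_cast hs.ne'
  set e := (MeasurableEquiv.piFinSuccAbove (fun _ : Fin (m + 1) => ℂ) 0).symm with he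
  have hmp : MeasurePreserving e volume volume :=
    (volume_preserving_piFinSuccAbove (fun _ : Fin (m + 1) => ℂ) 0).symm _
  have hev : ∀ ζ v, e (ζ, v) = (Fin.cons ζ v : Fin (m + 1) → ℂ) := by
    intro ζ v
    simp [he, MeasurableEquiv.piFinSuccAbove, Fin.consEquiv]
  have hslice : ∀ ζ : ℂ, Prod.mk ζ ⁻¹' (e ⁻¹' sqBall (m + 1) (s ^ 2)) =
      sqBall m (s ^ 2 - ‖ζ‖ ^ 2) := by
    intro ζ
    ext v
    simp only [Set.mem_preimage, hev, sqBall, Set.mem_ofPred_eq, Fin.sum_univ_succ, Fin.cons_zero,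
      Fin.cons_succ]
    exact lt_sub_iff_add_lt'.symm
  have hi' := (hmp.integrableOn_comp_preimage e.measurableEmbedding).2 hi
  obtain ⟨h1, h2, h3⟩ := fubini_slices
    (e.measurable (measurableSet_sqBall (m + 1) (s ^ 2))) hi'
  rw [← hmp.setIntegral_preimage_emb e.measurableEmbedding]
  simp only [Function.comp_def] at h1 h2 h3
  -- The kernel is constant on the slice over `ζ`, so the mean value property evaluates the integral
  -- over the slice. The equality is only almost everywhere, where the slice of `H` is integrable.
  have hin : (fun ζ => ∫ v in Prod.mk ζ ⁻¹' (e ⁻¹' sqBall (m + 1) (s ^ 2)), H (e (ζ, v)) /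
      ((s : ℂ) ^ 2 - r * conj (e (ζ, v) 0)) ^ (m + 2)) =ᵐ[volume]
      (Metric.ball (0 : ℂ) s).indicator (fun ζ => (Real.pi : ℂ) ^ m / m ! *
      (H (Fin.cons ζ 0) * ((s : ℂ) ^ 2 - ‖ζ‖ ^ 2) ^ m / ((s : ℂ) ^ 2 - r * conj ζ) ^ (m + 2))) := by
    filter_upwards [h1] with ζ hζ
    rw [hslice] at hζ ⊢
    simp only [hev, Fin.cons_zero] at hζ ⊢
    by_cases hm : ζ ∈ Metric.ball (0 : ℂ) s
    · rw [Set.indicator_of_mem hm]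
      have hζs : ‖ζ‖ < s := by simpa using hm
      have ht : 0 < s ^ 2 - ‖ζ‖ ^ 2 := by
        have := pow_lt_pow_left₀ hζs (norm_nonneg _) two_ne_zero
        linarith
      have hne : ((s : ℂ) ^ 2 - r * conj ζ) ^ (m + 2) ≠ 0 := by
        refine pow_ne_zero _ fun h0 => ?_
        have h1 : s ^ 2 = ‖r‖ * ‖ζ‖ := by
          have := congrArg norm (sub_eq_zero.1 h0)
          simpa [abs_of_pos hs] using this
        nlinarith [mul_lt_mul'' hr hζs (norm_nonneg _) (norm_nonneg _)]
      have hHi : IntegrableOn (fun v : Fin m → ℂ => H (Fin.cons ζ v))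
          (sqBall m (s ^ 2 - ‖ζ‖ ^ 2)) := by
        have := hζ.mul_const (((s : ℂ) ^ 2 - r * conj ζ) ^ (m + 2))
        simpa only [IntegrableOn, div_mul_cancel₀ _ hne] using this
      have hHd : DifferentiableOn ℂ (fun v : Fin m → ℂ => H (Fin.cons ζ v))
          (sqBall m (s ^ 2 - ‖ζ‖ ^ 2)) := by
        refine hH.comp (f := fun v : Fin m → ℂ => (Fin.cons ζ v : Fin (m + 1) → ℂ)) ?_ ?_
        · refine Differentiable.differentiableOn (differentiable_pi.2 fun i => ?_)
          refine Fin.cases ?_ (fun i => ?_) i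
          · simp
          · simp only [Fin.cons_succ]; fun_prop
        · intro v hv
          have := (Set.ext_iff.1 (hslice ζ) v).2 hv
          simpa only [Set.mem_preimage, hev] using this
      rw [integral_div, setIntegral_sqBall_eq ht hHd hHi]
      push_cast
      rw [mul_pow]
      ring
    · rw [Set.indicator_of_notMem hm]
      have : s ^ 2 - ‖ζ‖ ^ 2 ≤ 0 := by
        have : s ≤ ‖ζ‖ := by simpa using hm
        have := pow_le_pow_left₀ hs.le this 2
        linarith
      rw [sqBall_eq_empty m this]
      simp
  have hpi : (Real.pi : ℂ) ^ m / m ! ≠ 0 := by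
    have : (Real.pi : ℂ) ≠ 0 := by exact_mod_cast Real.pi_ne_zero
    have : (m ! : ℂ) ≠ 0 := by exact_mod_cast m.factorial_ne_zero
    positivity
  rw [h3, integral_congr_ae hin, integral_indicator Metric.isOpen_ball.measurableSet,
    integral_const_mul, setIntegral_disc_weighted m hr]
  · have : (m ! : ℂ) ≠ 0 := by exact_mod_cast m.factorial_ne_zero
    have : ((m : ℂ) + 1) ≠ 0 := by exact_mod_cast m.succ_ne_zero
    rw [Nat.factorial_succ]
    push_cast
    field_simp
    ring
  · refine hH.comp (f := fun ζ : ℂ => (Fin.cons ζ 0 : Fin (m + 1) → ℂ)) ?_ ?_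
    · refine Differentiable.differentiableOn (differentiable_pi.2 fun i => ?_)
      refine Fin.cases ?_ (fun i => ?_) i
      · simp
      · simp
    · intro ζ hζ
      have hζs : ‖ζ‖ < s := by simpa using hζ
      have := pow_lt_pow_left₀ hζs (norm_nonneg _) two_ne_zero
      simpa [sqBall, Fin.sum_univ_succ] using this
  · have := (integrable_indicator_iff Metric.isOpen_ball.measurableSet).1 (h2.congr hin)
    have h4 := Integrable.const_mul this ((Real.pi : ℂ) ^ m / m !)⁻¹
    simpa only [IntegrableOn, inv_mul_cancel_left₀ hpi] using h4

/-- The reproducing property of the Bergman kernel of the ball of radius `s`. -/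
lemma setIntegral_sqBall_kernel {n : ℕ} (hn : 1 ≤ n) {s : ℝ} (hs : 0 < s) {a : Fin n → ℂ}
    (ha : a ∈ sqBall n (s ^ 2)) {H : (Fin n → ℂ) → ℂ}
    (hH : DifferentiableOn ℂ H (sqBall n (s ^ 2)))
    (hi : IntegrableOn (fun u => H u / ((s : ℂ) ^ 2 - ∑ j, a j * conj (u j)) ^ (n + 1))
      (sqBall n (s ^ 2))) :
    ∫ u in sqBall n (s ^ 2), H u / ((s : ℂ) ^ 2 - ∑ j, a j * conj (u j)) ^ (n + 1) =
      (Real.pi : ℂ) ^ n / (n ! * (s : ℂ) ^ 2) * H a := by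
  obtain ⟨m, rfl⟩ : ∃ m, n = m + 1 := ⟨n - 1, by omega⟩
  obtain ⟨U, r, hU, hUa, hUr⟩ := exists_linearEquiv_axis a
  have hmp := measurePreserving_of_sum_norm_sq U hU
  have hemb : MeasurableEmbedding U :=
    (U.toContinuousLinearEquiv.toHomeomorph).measurableEmbedding
  have hpre : U ⁻¹' sqBall (m + 1) (s ^ 2) = sqBall (m + 1) (s ^ 2) := by
    ext u; simp [sqBall, hU]
  have hr : ‖r‖ < s := by
    refine lt_of_pow_lt_pow_left₀ 2 hs.le ?_
    have h1 := hU (Fin.cons r 0)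
    rw [hUa] at h1
    simp only [Fin.sum_univ_succ, Fin.cons_zero, Fin.cons_succ, Pi.zero_apply, norm_zero] at h1
    have h2 : ∑ j, ‖a j‖ ^ 2 < s ^ 2 := ha
    rw [Fin.sum_univ_succ, h1] at h2
    simpa using h2
  have hi' := (hmp.integrableOn_comp_preimage hemb).2 hi
  rw [← hmp.setIntegral_preimage_emb hemb, hpre]
  rw [hpre] at hi'
  simp only [Function.comp_def, hUr] at hi' ⊢
  rw [setIntegral_sqBall_kernel_axis (H := fun u => H (U u)) hr ?_ hi', hUa]
  refine hH.comp (f := U) U.toContinuousLinearEquiv.differentiable.differentiableOn ?_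
  intro u hu
  rw [← hpre] at hu
  exact hu

/-! ### Square integrable holomorphic functions on the punctured disc -/

/-- The Cauchy–Schwarz inequality against the constant function `1`. -/
lemma sq_integral_norm_le {α : Type*} [MeasurableSpace α] {μ : Measure α} [IsFiniteMeasure μ]
    {f : α → ℂ} (hf : MemLp f 2 μ) :
    (∫ x, ‖f x‖ ∂μ) ^ 2 ≤ μ.real Set.univ * ∫ x, ‖f x‖ ^ 2 ∂μ := by
  have h1 : Integrable (fun x => ‖f x‖) μ := (hf.integrable one_le_two).norm
  have h2 : Integrable (fun x => ‖f x‖ ^ 2) μ := hf.integrable_norm_pow two_ne_zero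
  -- The integral of `(‖f‖ - c) ^ 2` is a nonnegative quadratic polynomial in `c`.
  have h := discrim_le_zero (a := μ.real Set.univ) (b := -2 * ∫ x, ‖f x‖ ∂μ)
    (c := ∫ x, ‖f x‖ ^ 2 ∂μ) fun c => by
      have h3 : 0 ≤ ∫ x, (‖f x‖ - c) ^ 2 ∂μ := integral_nonneg fun x => sq_nonneg _
      have h4 : ∫ x, (‖f x‖ - c) ^ 2 ∂μ =
          ∫ x, ‖f x‖ ^ 2 ∂μ - 2 * c * ∫ x, ‖f x‖ ∂μ + c ^ 2 * μ.real Set.univ := by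
        have e : ∀ x, (‖f x‖ - c) ^ 2 = (‖f x‖ ^ 2 - 2 * c * ‖f x‖) + c ^ 2 := fun x => by ring
        simp only [e]
        rw [integral_add (f := fun x => ‖f x‖ ^ 2 - 2 * c * ‖f x‖)
            (h2.sub (h1.const_mul _)) (integrable_const _),
          integral_sub h2 (h1.const_mul _), integral_const_mul, integral_const, smul_eq_mul]
        ring
      linarith
  rw [discrim] at h
  linarith

/-- The value of a holomorphic function at the centre of a disc is controlled by its `L²` norm. -/
lemma pow_mul_norm_sq_le {f : ℂ → ℂ} {z : ℂ} {s : ℝ} (hs : 0 < s)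
    (hd : DifferentiableOn ℂ f (Metric.ball z s))
    (hL : MemLp f 2 (volume.restrict (Metric.ball z s))) :
    (s * ‖f z‖) ^ 2 ≤ (∫ ζ in Metric.ball z s, ‖f ζ‖ ^ 2) / Real.pi := by
  have hfin : IsFiniteMeasure (volume.restrict (Metric.ball z s)) :=
    ⟨by rw [Measure.restrict_apply_univ]; exact measure_ball_lt_top⟩
  have hi : IntegrableOn f (Metric.ball z s) := hL.integrable one_le_two
  have hs0 : (s : ℂ) ≠ 0 := by exact_mod_cast hs.ne'
  have hmp : MeasurePreserving (fun ζ : ℂ => z + ζ) volume volume := measurePreserving_add_left _ z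
  have hemb : MeasurableEmbedding (fun ζ : ℂ => z + ζ) := measurableEmbedding_addLeft z
  have hpre : (fun ζ : ℂ => z + ζ) ⁻¹' Metric.ball z s = Metric.ball 0 s := by
    ext ζ; simp
  have hi' := (hmp.integrableOn_comp_preimage hemb).2 hi
  have h1 := hmp.setIntegral_preimage_emb hemb f (Metric.ball z s)
  rw [hpre] at hi' h1
  have h2 := setIntegral_disc_weighted (s := s) (r := 0) (F := fun ζ => f (z + ζ)) 0
    (by simpa using hs)
    (hd.comp (f := fun ζ : ℂ => z + ζ) (by fun_prop) fun ζ hζ => by rw [← hpre] at hζ; exact hζ)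
    (by simpa [IntegrableOn, Function.comp_def] using hi'.div_const (((s : ℂ) ^ 2) ^ 2))
  simp only [pow_zero, mul_one, zero_mul, sub_zero, add_zero, zero_add, Nat.cast_zero,
    one_mul] at h2
  rw [integral_div, h1] at h2
  have h3 : ∫ ζ in Metric.ball z s, f ζ = Real.pi * (s : ℂ) ^ 2 * f z := by
    field_simp at h2 ⊢
    linear_combination h2
  have h4 : Real.pi * s ^ 2 * ‖f z‖ ≤ ∫ ζ in Metric.ball z s, ‖f ζ‖ := by
    have := norm_integral_le_integral_norm (μ := volume.restrict (Metric.ball z s)) f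
    rw [h3] at this
    simpa [abs_of_pos hs, abs_of_pos Real.pi_pos] using this
  have h5 := (pow_le_pow_left₀ (by positivity) h4 2).trans (sq_integral_norm_le hL)
  have h6 : (volume.restrict (Metric.ball z s)).real Set.univ = Real.pi * s ^ 2 := by
    rw [measureReal_restrict_apply MeasurableSet.univ, Set.univ_inter, Measure.real,
      Complex.volume_ball]
    simp [hs.le, mul_comm]
  rw [h6] at h5
  rw [le_div_iff₀ Real.pi_pos]
  have h7 : 0 < Real.pi * s ^ 2 := by positivity
  refine le_of_mul_le_mul_left ?_ h7
  calc _ = (Real.pi * s ^ 2 * ‖f z‖) ^ 2 := by ring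
    _ ≤ _ := h5

/-- A square integrable holomorphic function on the punctured disc is `o(1/z)` at the puncture,
hence the singularity is removable: apply `pow_mul_norm_sq_le` on the disc of centre `z` and radius
`|z|`, over which the integral of `|f|²` tends to zero. -/
lemma isLittleO_inv_of_memLp {f : ℂ → ℂ}
    (hd : DifferentiableOn ℂ f (Metric.ball 0 1 \ {0}))
    (hL : MemLp f 2 (volume.restrict (Metric.ball 0 1 \ {0}))) :
    (fun z => f z - f 0) =o[nhdsWithin 0 {0}ᶜ] fun z => (z - 0)⁻¹ := by
  have hinf : Filter.Tendsto (fun z : ℂ => (z - 0)⁻¹) (nhdsWithin 0 {0}ᶜ)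
      (Bornology.cobounded ℂ) := by
    simpa using Filter.tendsto_inv₀_nhdsNE_zero (α := ℂ)
  refine Asymptotics.IsLittleO.sub ?_ (Asymptotics.isLittleO_const_left.2 (Or.inr
    (tendsto_norm_cobounded_atTop.comp hinf)))
  have hvol : Filter.Tendsto (fun z : ℂ => (volume.restrict (Metric.ball (0 : ℂ) 1 \ {0}))
      (Metric.ball (0 : ℂ) (2 * ‖z‖))) (nhdsWithin 0 {0}ᶜ) (nhds 0) := by
    have h0 : Filter.Tendsto (fun z : ℂ => ENNReal.ofReal (2 * ‖z‖) ^ 2 * NNReal.pi) (nhds 0)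
        (nhds 0) := by
      have : Continuous fun z : ℂ => ENNReal.ofReal (2 * ‖z‖) :=
        ENNReal.continuous_ofReal.comp (by fun_prop)
      have h := ENNReal.Tendsto.mul_const (b := (NNReal.pi : ENNReal))
        (ENNReal.Tendsto.pow (n := 2) (this.tendsto 0)) (Or.inr ENNReal.coe_ne_top)
      simpa using h
    refine tendsto_of_tendsto_of_tendsto_of_le_of_le tendsto_const_nhds
      (h0.mono_left nhdsWithin_le_nhds) (fun _ => zero_le) fun z => ?_
    rw [← Complex.volume_ball (0 : ℂ)]
    exact Measure.restrict_apply_le _ _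
  have hJ := (hL.integrable_norm_pow two_ne_zero).tendsto_setIntegral_nhds_zero hvol
  have hJ' := (hJ.div_const Real.pi).sqrt
  rw [zero_div, Real.sqrt_zero] at hJ'
  rw [Asymptotics.isLittleO_iff_tendsto']
  swap
  · filter_upwards [self_mem_nhdsWithin] with z hz h
    exact absurd (by simpa using h) hz
  refine squeeze_zero_norm' ?_ hJ'
  have hsmall : ∀ᶠ z : ℂ in nhdsWithin 0 {0}ᶜ, ‖z‖ < 1 / 2 := by
    refine nhdsWithin_le_nhds ?_
    filter_upwards [Metric.ball_mem_nhds (0 : ℂ) (by norm_num : (0 : ℝ) < 1 / 2)] with z hz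
    simpa using hz
  filter_upwards [self_mem_nhdsWithin, hsmall] with z hz hz2
  have hz0 : 0 < ‖z‖ := norm_pos_iff.2 hz
  have hsub : Metric.ball z ‖z‖ ⊆ Metric.ball (0 : ℂ) (2 * ‖z‖) ∩ (Metric.ball 0 1 \ {0}) := by
    intro ζ hζ
    rw [Metric.mem_ball, dist_eq_norm] at hζ
    have h1 : ‖ζ‖ < 2 * ‖z‖ := by
      have := norm_add_le (ζ - z) z
      rw [sub_add_cancel] at this
      linarith
    refine ⟨by simpa using h1, ?_, ?_⟩
    · simp only [mem_ball_zero_iff]; linarith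
    · rintro rfl
      simp at hζ
  have h1 := pow_mul_norm_sq_le hz0 (hd.mono (hsub.trans Set.inter_subset_right))
    (hL.mono_measure (Measure.restrict_mono_set _ (hsub.trans Set.inter_subset_right)))
  have h2 : ∫ ζ in Metric.ball z ‖z‖, ‖f ζ‖ ^ 2 ≤
      ∫ ζ in Metric.ball (0 : ℂ) (2 * ‖z‖), ‖f ζ‖ ^ 2
        ∂(volume.restrict (Metric.ball (0 : ℂ) 1 \ {0})) := by
    rw [Measure.restrict_restrict Metric.isOpen_ball.measurableSet]
    refine setIntegral_mono_set ?_ (Filter.Eventually.of_forall fun _ => by positivity)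
      (LE.le.eventuallyLE hsub)
    exact IntegrableOn.mono_set (hL.integrable_norm_pow two_ne_zero) Set.inter_subset_right
  have h3 : ‖f z / (z - 0)⁻¹‖ = ‖z‖ * ‖f z‖ := by
    rw [sub_zero, div_inv_eq_mul, norm_mul, mul_comm]
  rw [h3]
  refine Real.le_sqrt_of_sq_le (h1.trans ?_)
  gcongr

/-- The kernel `1 / (π (1 - r ζ̄)²)` of the disc is reproducing on the punctured disc. -/
lemma setIntegral_punctured_disc_kernel {f : ℂ → ℂ}
    (hd : DifferentiableOn ℂ f (Metric.ball 0 1 \ {0}))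
    (hL : MemLp f 2 (volume.restrict (Metric.ball 0 1 \ {0}))) {r : ℂ}
    (hr : r ∈ Metric.ball (0 : ℂ) 1 \ {0}) :
    ∫ ζ in Metric.ball (0 : ℂ) 1 \ {0}, f ζ / (1 - r * conj ζ) ^ 2 = Real.pi * f r := by
  have hr1 : ‖r‖ < 1 := by simpa using hr.1
  have hF := Complex.differentiableOn_update_limUnder_of_isLittleO
    (Metric.ball_mem_nhds (0 : ℂ) one_pos) hd (isLittleO_inv_of_memLp hd hL)
  set F := Function.update f 0 ((nhdsWithin 0 {0}ᶜ).limUnder f) with hFdef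
  have hFf : ∀ ζ, ζ ≠ 0 → F ζ = f ζ := fun ζ hζ => Function.update_of_ne hζ _ _
  have hae : (Metric.ball (0 : ℂ) 1 \ {0} : Set ℂ) =ᵐ[volume] Metric.ball (0 : ℂ) 1 :=
    sdiff_null_ae_eq_self (measure_singleton 0)
  have hmeas : MeasurableSet (Metric.ball (0 : ℂ) 1 \ {0}) :=
    Metric.isOpen_ball.measurableSet.diff (measurableSet_singleton 0)
  have hfin : IsFiniteMeasure (volume.restrict (Metric.ball (0 : ℂ) 1)) :=
    ⟨by rw [Measure.restrict_apply_univ]; exact measure_ball_lt_top⟩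
  have hres := Measure.restrict_congr_set hae
  have hFi : IntegrableOn F (Metric.ball 0 1) := by
    rw [hres] at hL
    have h := hL.integrable one_le_two
    rw [← hres] at h
    rw [IntegrableOn, ← hres]
    refine h.congr ((ae_restrict_iff' hmeas).2 (Filter.Eventually.of_forall fun ζ hζ => ?_))
    exact (hFf ζ hζ.2).symm
  have h1 := setIntegral_disc_weighted (s := 1) (r := r) (F := F) 0 hr1 hF ?_
  · simp only [pow_zero, mul_one, zero_add, Nat.cast_zero, Complex.ofReal_one, one_pow,
      div_one] at h1
    rw [hFf r hr.2, ← hres] at h1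
    rw [← h1]
    refine setIntegral_congr_fun hmeas fun ζ hζ => ?_
    simp only [hFf ζ hζ.2]
  · have hden : ∀ ζ ∈ Metric.ball (0 : ℂ) 1, 1 - ‖r‖ ≤ ‖1 - r * conj ζ‖ := by
      intro ζ hζ
      have h2 : ‖ζ‖ < 1 := by simpa using hζ
      have h3 := norm_sub_norm_le (1 : ℂ) (r * conj ζ)
      rw [norm_one, norm_mul, RCLike.norm_conj] at h3
      nlinarith [norm_nonneg r]
    simp only [pow_zero, mul_one, zero_add, Complex.ofReal_one, one_pow]
    have hpos : 0 < 1 - ‖r‖ := by linarith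
    refine Integrable.mono' (hFi.norm.mul_const ((1 - ‖r‖) ^ 2)⁻¹) ?_ ?_
    · refine ContinuousOn.aestronglyMeasurable ?_ Metric.isOpen_ball.measurableSet
      refine hF.continuousOn.div (g := fun ζ => (1 - r * conj ζ) ^ 2) (by fun_prop)
        fun ζ hζ => pow_ne_zero _ ?_
      exact norm_pos_iff.1 (hpos.trans_le (hden ζ hζ))
    · refine (ae_restrict_iff' Metric.isOpen_ball.measurableSet).2
        (Filter.Eventually.of_forall fun ζ hζ => ?_)
      rw [norm_div, norm_pow, div_eq_mul_inv]
      have := hden ζ hζ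
      gcongr

/-! ### Bounds for the kernel of the Hartogs triangle -/

lemma le_norm_sq_sub_sum {n : ℕ} {s σ : ℝ} (hs : 0 ≤ s) (hσ : 0 ≤ σ) {a u : Fin n → ℂ}
    (ha : ∑ j, ‖a j‖ ^ 2 ≤ (σ * s) ^ 2) (hu : u ∈ sqBall n (s ^ 2)) :
    s ^ 2 * (1 - σ) ≤ ‖(s : ℂ) ^ 2 - ∑ j, a j * conj (u j)‖ := by
  have h1 := norm_sum_mul_conj_le (by positivity) hs ha (le_of_lt hu)
  have h2 := norm_sub_norm_le ((s : ℂ) ^ 2) (∑ j, a j * conj (u j))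
  rw [norm_pow, Complex.norm_real, Real.norm_eq_abs, sq_abs] at h2
  nlinarith

lemma integrableOn_sqBall_kernel {n : ℕ} {s σ : ℝ} (hs : 0 < s) (hσ : 0 ≤ σ) (hσ1 : σ < 1)
    {a : Fin n → ℂ} (ha : ∑ j, ‖a j‖ ^ 2 ≤ (σ * s) ^ 2) {H : (Fin n → ℂ) → ℂ}
    (hi : IntegrableOn H (sqBall n (s ^ 2))) :
    IntegrableOn (fun u => H u / ((s : ℂ) ^ 2 - ∑ j, a j * conj (u j)) ^ (n + 1))
      (sqBall n (s ^ 2)) := by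
  have hpos : 0 < s ^ 2 * (1 - σ) := mul_pos (by positivity) (by linarith)
  simp only [div_eq_mul_inv]
  refine Integrable.mul_bdd (c := ((s ^ 2 * (1 - σ)) ^ (n + 1))⁻¹) hi ?_ ?_
  · refine ContinuousOn.aestronglyMeasurable (ContinuousOn.inv₀ (by fun_prop) fun u hu => ?_)
      (measurableSet_sqBall _ _)
    exact pow_ne_zero _ (norm_pos_iff.1 (hpos.trans_le (le_norm_sq_sub_sum hs.le hσ ha hu)))
  · refine (ae_restrict_iff' (measurableSet_sqBall _ _)).2 (Filter.Eventually.of_forall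
      fun u hu => ?_)
    rw [norm_inv, norm_pow]
    have := le_norm_sq_sub_sum hs.le hσ ha hu
    gcongr

/-- Point evaluations on the ball of radius `s` are bounded in the `L²` norm, with the dependence on
`s` made explicit; `σ` bounds the relative distance of the point from the centre. -/
lemma pow_mul_norm_sq_le_of_sqBall {n : ℕ} (hn : 1 ≤ n) {s σ : ℝ} (hs : 0 < s) (hσ : 0 ≤ σ)
    (hσ1 : σ < 1) {a : Fin n → ℂ} (ha : ∑ j, ‖a j‖ ^ 2 ≤ (σ * s) ^ 2) {H : (Fin n → ℂ) → ℂ}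
    (hH : DifferentiableOn ℂ H (sqBall n (s ^ 2)))
    (hL : MemLp H 2 (volume.restrict (sqBall n (s ^ 2)))) :
    (s ^ n * ‖H a‖) ^ 2 ≤ n ! / (Real.pi ^ n * (1 - σ) ^ (2 * (n + 1))) *
      ∫ u in sqBall n (s ^ 2), ‖H u‖ ^ 2 := by
  have hfin : IsFiniteMeasure (volume.restrict (sqBall n (s ^ 2))) :=
    ⟨by rw [Measure.restrict_apply_univ]; exact volume_sqBall_lt_top _ _⟩
  have hi : IntegrableOn H (sqBall n (s ^ 2)) := hL.integrable one_le_two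
  have hpos : 0 < 1 - σ := by linarith
  have hmem : a ∈ sqBall n (s ^ 2) := by
    refine lt_of_le_of_lt ha ?_
    rw [mul_pow]
    exact mul_lt_of_lt_one_left (by positivity) (pow_lt_one₀ hσ hσ1 two_ne_zero)
  have h1 := setIntegral_sqBall_kernel hn hs hmem hH (integrableOn_sqBall_kernel hs hσ hσ1 ha hi)
  have h2 : ‖∫ u in sqBall n (s ^ 2), H u / ((s : ℂ) ^ 2 - ∑ j, a j * conj (u j)) ^ (n + 1)‖ ≤
      ∫ u in sqBall n (s ^ 2), ‖H u‖ / (s ^ 2 * (1 - σ)) ^ (n + 1) := by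
    refine norm_integral_le_of_norm_le (hi.norm.div_const _) ?_
    refine (ae_restrict_iff' (measurableSet_sqBall _ _)).2 (Filter.Eventually.of_forall
      fun u hu => ?_)
    rw [norm_div, norm_pow]
    have := le_norm_sq_sub_sum hs.le hσ ha hu
    gcongr
  rw [h1, integral_div] at h2
  have h3 : ‖(Real.pi : ℂ) ^ n / (n ! * (s : ℂ) ^ 2) * H a‖ =
      Real.pi ^ n / (n ! * s ^ 2) * ‖H a‖ := by
    simp [abs_of_pos Real.pi_pos]
  rw [h3, le_div_iff₀ (by positivity)] at h2
  have h4 := (pow_le_pow_left₀ (by positivity) h2 2).trans (sq_integral_norm_le hL)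
  rw [measureReal_restrict_apply MeasurableSet.univ, Set.univ_inter,
    volume_real_sqBall n (by positivity)] at h4
  have hpi := Real.pi_pos
  rw [div_mul_eq_mul_div, le_div_iff₀ (by positivity)]
  have h5 : 0 < Real.pi ^ n * s ^ (2 * n) / (n ! : ℝ) ^ 2 := by positivity
  refine le_of_mul_le_mul_left ?_ h5
  calc _ = (Real.pi ^ n / (n ! * s ^ 2) * ‖H a‖ * (s ^ 2 * (1 - σ)) ^ (n + 1)) ^ 2 := by
        generalize 1 - σ = τ
        field_simp
        ring
    _ ≤ _ := h4
    _ = _ := by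
        field_simp
        ring

lemma mem_hartogsTriangle_iff {n k : ℕ} (hk : 1 ≤ k) {x : ℂ} {y : Fin n → ℂ} :
    (x, y) ∈ hartogsTriangle n k ↔
      x ∈ Metric.ball (0 : ℂ) 1 \ {0} ∧ y ∈ sqBall n ((‖x‖ ^ k) ^ 2) := by
  have hk0 : 2 * k ≠ 0 := by omega
  simp only [hartogsTriangle, sqBall, Set.mem_ofPred_eq, Set.mem_sdiff, mem_ball_zero_iff,
    Set.mem_singleton_iff, ← pow_mul, mul_comm k 2, pow_lt_one_iff_of_nonneg (norm_nonneg x) hk0]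
  constructor
  · rintro ⟨h1, h2⟩
    refine ⟨⟨h2, ?_⟩, h1⟩
    rintro rfl
    rw [norm_zero, zero_pow hk0] at h1
    exact absurd h1 (not_lt.2 (by positivity))
  · rintro ⟨⟨h1, -⟩, h2⟩
    exact ⟨h2, h1⟩

lemma isOpen_hartogsTriangle (n k : ℕ) : IsOpen (hartogsTriangle n k) := by
  rw [hartogsTriangle, Set.ofPred_and]
  refine IsOpen.inter (isOpen_lt ?_ ?_) (isOpen_lt ?_ ?_) <;> fun_prop

lemma slice_hartogsTriangle_of_mem {n k : ℕ} (hk : 1 ≤ k) {x : ℂ}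
    (hx : x ∈ Metric.ball (0 : ℂ) 1 \ {0}) :
    Prod.mk x ⁻¹' hartogsTriangle n k = sqBall n ((‖x‖ ^ k) ^ 2) := by
  ext y
  rw [Set.mem_preimage, mem_hartogsTriangle_iff hk, and_iff_right hx]

lemma slice_hartogsTriangle_of_notMem {n k : ℕ} (hk : 1 ≤ k) {x : ℂ}
    (hx : x ∉ Metric.ball (0 : ℂ) 1 \ {0}) :
    Prod.mk x ⁻¹' hartogsTriangle n k = ∅ := by
  ext y
  rw [Set.mem_preimage, mem_hartogsTriangle_iff hk]
  simp only [hx, false_and, Set.mem_empty_iff_false]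

/-- The Bergman kernel of the Hartogs triangle in polarized form: it is holomorphic in both
variables, and the Bergman kernel is `(p, q) ↦ hartogsKernel n k p (star q)`. -/
noncomputable def hartogsKernel (n k : ℕ) (p q : ℂ × (Fin n → ℂ)) : ℂ :=
  (n ! : ℂ) * (p.1 * q.1) ^ k / ((Real.pi : ℂ) ^ (n + 1) * (1 - p.1 * q.1) ^ 2 *
    ((p.1 * q.1) ^ k - ∑ j, p.2 j * q.2 j) ^ (n + 1))

lemma star_mem_hartogsTriangle {n k : ℕ} {p : ℂ × (Fin n → ℂ)} :
    star p ∈ hartogsTriangle n k ↔ p ∈ hartogsTriangle n k := by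
  simp [hartogsTriangle]

lemma conj_hartogsKernel {n k : ℕ} (p q : ℂ × (Fin n → ℂ)) :
    conj (hartogsKernel n k p q) = hartogsKernel n k (star p) (star q) := by
  simp [hartogsKernel]

/-- The quantity `|z|^k - |w|`, positive on the Hartogs triangle, measures how far the last factor
of the denominator of the kernel stays away from zero (`hartogs_gap_le`). -/
lemma hartogs_gap_pos {n k : ℕ} {p : ℂ × (Fin n → ℂ)} (hp : p ∈ hartogsTriangle n k) :
    0 < ‖p.1‖ ^ k - Real.sqrt (∑ j, ‖p.2 j‖ ^ 2) := by
  rw [sub_pos, Real.sqrt_lt' ?_]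
  · rw [← pow_mul, mul_comm k 2]; exact hp.1
  · rcases (norm_nonneg p.1).eq_or_lt with h | h
    · have h1 := hp.1
      by_cases hk : k = 0
      · simp [hk]
      · rw [← h, zero_pow (by omega)] at h1
        exact absurd h1 (not_lt.2 (by positivity))
    · positivity

lemma hartogs_gap_le {n k : ℕ} {p q : ℂ × (Fin n → ℂ)} (hq : q ∈ hartogsTriangle n k) :
    ‖q.1‖ ^ k * (‖p.1‖ ^ k - Real.sqrt (∑ j, ‖p.2 j‖ ^ 2)) ≤
      ‖(p.1 * q.1) ^ k - ∑ j, p.2 j * q.2 j‖ := by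
  have h1 := norm_sum_mul_conj_le (a := p.2) (u := fun j => conj (q.2 j))
    (Real.sqrt_nonneg (∑ j, ‖p.2 j‖ ^ 2)) (by positivity : (0 : ℝ) ≤ ‖q.1‖ ^ k)
    (Real.sq_sqrt (by positivity)).ge
    (by simpa [← pow_mul, mul_comm k 2] using hq.1.le)
  simp only [Complex.conj_conj] at h1
  have h2 := norm_sub_norm_le ((p.1 * q.1) ^ k) (∑ j, p.2 j * q.2 j)
  rw [norm_pow, norm_mul, mul_pow] at h2
  linarith

/-- The factor depending on `p` in the bound `norm_hartogsKernel_le` for the kernel. -/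
noncomputable def hartogsBound (n k : ℕ) (p : ℂ × (Fin n → ℂ)) : ℝ :=
  n ! / (Real.pi ^ (n + 1) * (1 - ‖p.1‖) ^ 2 *
    (‖p.1‖ ^ k - Real.sqrt (∑ j, ‖p.2 j‖ ^ 2)) ^ (n + 1))

lemma norm_lt_one_of_mem {n k : ℕ} (hk : 1 ≤ k) {p : ℂ × (Fin n → ℂ)}
    (hp : p ∈ hartogsTriangle n k) : ‖p.1‖ < 1 := by
  have := ((mem_hartogsTriangle_iff hk).1 hp).1.1
  simpa using this

lemma fst_ne_zero_of_mem {n k : ℕ} (hk : 1 ≤ k) {p : ℂ × (Fin n → ℂ)}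
    (hp : p ∈ hartogsTriangle n k) : p.1 ≠ 0 := by
  exact ((mem_hartogsTriangle_iff hk).1 hp).1.2

lemma one_sub_norm_le {z x : ℂ} (hx : ‖x‖ ≤ 1) : 1 - ‖z‖ ≤ ‖1 - z * x‖ := by
  have h3 := norm_sub_norm_le (1 : ℂ) (z * x)
  rw [norm_one, norm_mul] at h3
  nlinarith [norm_nonneg z]

lemma norm_hartogsKernel_le {n k : ℕ} (hk : 1 ≤ k) {p q : ℂ × (Fin n → ℂ)}
    (hp : p ∈ hartogsTriangle n k) (hq : q ∈ hartogsTriangle n k) :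
    ‖hartogsKernel n k p q‖ ≤ hartogsBound n k p * (‖q.1‖ ^ (k * n))⁻¹ := by
  have hg := hartogs_gap_pos hp
  have hp1 : 0 < 1 - ‖p.1‖ := sub_pos.2 (norm_lt_one_of_mem hk hp)
  have hq1 := norm_lt_one_of_mem hk hq
  have hq0 : 0 < ‖q.1‖ := norm_pos_iff.2 (fst_ne_zero_of_mem hk hq)
  have h1 := hartogs_gap_le (p := p) hq
  have h2 := one_sub_norm_le (z := p.1) hq1.le
  have hpi := Real.pi_pos
  have h3 : ‖hartogsKernel n k p q‖ = n ! * (‖p.1‖ ^ k * ‖q.1‖ ^ k) / (Real.pi ^ (n + 1) *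
      ‖1 - p.1 * q.1‖ ^ 2 * ‖(p.1 * q.1) ^ k - ∑ j, p.2 j * q.2 j‖ ^ (n + 1)) := by
    simp [hartogsKernel, abs_of_pos hpi, mul_pow]
  rw [h3, hartogsBound]
  set g := ‖p.1‖ ^ k - Real.sqrt (∑ j, ‖p.2 j‖ ^ 2)
  calc _ ≤ n ! * (1 * ‖q.1‖ ^ k) / (Real.pi ^ (n + 1) *
      (1 - ‖p.1‖) ^ 2 * (‖q.1‖ ^ k * g) ^ (n + 1)) := by
        gcongr
        exact pow_le_one₀ (norm_nonneg _) (by linarith)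
    _ = _ := by
        field_simp
        ring_nf

lemma hartogs_den_ne_zero {n k : ℕ} (hk : 1 ≤ k) {p q : ℂ × (Fin n → ℂ)}
    (hp : p ∈ hartogsTriangle n k) (hq : q ∈ hartogsTriangle n k) :
    (Real.pi : ℂ) ^ (n + 1) * (1 - p.1 * q.1) ^ 2 *
    ((p.1 * q.1) ^ k - ∑ j, p.2 j * q.2 j) ^ (n + 1) ≠ 0 := by
  have hq0 : 0 < ‖q.1‖ := norm_pos_iff.2 (fst_ne_zero_of_mem hk hq)
  refine mul_ne_zero (mul_ne_zero (pow_ne_zero _ (by exact_mod_cast Real.pi_ne_zero))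
    (pow_ne_zero _ ?_)) (pow_ne_zero _ ?_)
  · exact norm_pos_iff.1 ((sub_pos.2 (norm_lt_one_of_mem hk hp)).trans_le
      (one_sub_norm_le (norm_lt_one_of_mem hk hq).le))
  · exact norm_pos_iff.1 ((mul_pos (by positivity) (hartogs_gap_pos hp)).trans_le
      (hartogs_gap_le hq))

lemma contDiffOn_hartogsKernel {n k : ℕ} (hk : 1 ≤ k) :
    ContDiffOn ℂ 1 (fun P : (ℂ × (Fin n → ℂ)) × (ℂ × (Fin n → ℂ)) => hartogsKernel n k P.1 P.2)
      (hartogsTriangle n k ×ˢ hartogsTriangle n k) := by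
  unfold hartogsKernel
  refine ContDiffOn.div (by fun_prop) (by fun_prop) fun P hP => hartogs_den_ne_zero hk hP.1 hP.2

lemma differentiableOn_hartogsKernel_right {n k : ℕ} (hk : 1 ≤ k) {p : ℂ × (Fin n → ℂ)}
    (hp : p ∈ hartogsTriangle n k) :
    DifferentiableOn ℂ (fun q => hartogsKernel n k p q) (hartogsTriangle n k) :=
  ((contDiffOn_hartogsKernel hk).differentiableOn one_ne_zero).comp
    (f := fun q => (p, q)) (by fun_prop) fun _ hq => ⟨hp, hq⟩

lemma continuousOn_hartogsKernel_star {n k : ℕ} (hk : 1 ≤ k) {p : ℂ × (Fin n → ℂ)}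
    (hp : p ∈ hartogsTriangle n k) :
    ContinuousOn (fun q => hartogsKernel n k p (star q)) (hartogsTriangle n k) :=
  (differentiableOn_hartogsKernel_right hk hp).continuousOn.comp continuous_star.continuousOn
    fun _ hq => star_mem_hartogsTriangle.2 hq

/-- The factor depending on `q` in the bound for the kernel is square integrable, because the slice
over `x` has volume `π^n |x|^{2kn} / n!`. -/
lemma memLp_inv_norm_pow {n k : ℕ} (hk : 1 ≤ k) :
    MemLp (fun q : ℂ × (Fin n → ℂ) => (‖q.1‖ ^ (k * n))⁻¹) 2
      (volume.restrict (hartogsTriangle n k)) := by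
  have hm := (isOpen_hartogsTriangle n k).measurableSet
  rw [memLp_two_iff_integrable_sq (by fun_prop)]
  refine ⟨by fun_prop, ?_⟩
  rw [HasFiniteIntegral, ← lintegral_indicator hm, Measure.volume_eq_prod,
    lintegral_prod _ (by fun_prop (disch := exact hm))]
  have h1 : ∀ x : ℂ, ∫⁻ y, (hartogsTriangle n k).indicator
      (fun q : ℂ × (Fin n → ℂ) => ‖((‖q.1‖ ^ (k * n))⁻¹) ^ 2‖ₑ) (x, y) =
      (Metric.ball (0 : ℂ) 1 \ {0}).indicator
        (fun _ => ENNReal.ofReal (Real.pi ^ n / n !)) x := by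
    intro x
    have e : (fun y => (hartogsTriangle n k).indicator
      (fun q : ℂ × (Fin n → ℂ) => ‖((‖q.1‖ ^ (k * n))⁻¹) ^ 2‖ₑ) (x, y)) =
      (Prod.mk x ⁻¹' hartogsTriangle n k).indicator fun _ => ‖((‖x‖ ^ (k * n))⁻¹) ^ 2‖ₑ := rfl
    rw [e, lintegral_indicator (measurable_prodMk_left hm), setLIntegral_const]
    by_cases hx : x ∈ Metric.ball (0 : ℂ) 1 \ {0}
    · rw [slice_hartogsTriangle_of_mem hk hx]
      have hx0 : 0 < ‖x‖ := norm_pos_iff.2 hx.2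
      rw [Set.indicator_of_mem hx, volume_sqBall n (by positivity), Real.enorm_eq_ofReal
        (by positivity), ← ENNReal.ofReal_mul (by positivity)]
      congr 1
      field_simp
      ring
    · rw [Set.indicator_of_notMem hx, slice_hartogsTriangle_of_notMem hk hx]
      simp
  simp only [h1]
  rw [lintegral_indicator (Metric.isOpen_ball.measurableSet.diff (measurableSet_singleton 0)),
    setLIntegral_const]
  refine ENNReal.mul_lt_top ENNReal.ofReal_lt_top ?_
  exact (measure_mono Set.sdiff_subset).trans_lt measure_ball_lt_top

lemma memLp_hartogsKernel {n k : ℕ} (hk : 1 ≤ k) {p : ℂ × (Fin n → ℂ)}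
    (hp : p ∈ hartogsTriangle n k) :
    MemLp (fun q => hartogsKernel n k p (star q)) 2 (volume.restrict (hartogsTriangle n k)) := by
  have hm := (isOpen_hartogsTriangle n k).measurableSet
  refine ((memLp_inv_norm_pow hk).const_mul (hartogsBound n k p)).mono
    ((continuousOn_hartogsKernel_star hk hp).aestronglyMeasurable hm) ?_
  refine (ae_restrict_iff' hm).2 (Filter.Eventually.of_forall fun q hq => ?_)
  refine (norm_hartogsKernel_le hk hp (star_mem_hartogsTriangle.2 hq)).trans
    ((le_of_eq ?_).trans (le_abs_self _))
  simp

/-! ### The reproducing property and the Bergman projection -/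

/-- The reproducing property of the kernel of the Hartogs triangle: integrate over the balls that
are the slices for fixed first coordinate, then over the punctured disc. -/
lemma setIntegral_hartogsKernel_mul {n k : ℕ} (hn : 1 ≤ n) (hk : 1 ≤ k) {p : ℂ × (Fin n → ℂ)}
    (hp : p ∈ hartogsTriangle n k) {h : ℂ × (Fin n → ℂ) → ℂ}
    (hd : DifferentiableOn ℂ h (hartogsTriangle n k))
    (hL : MemLp h 2 (volume.restrict (hartogsTriangle n k))) :
    ∫ q in hartogsTriangle n k, hartogsKernel n k p (star q) * h q = h p := by
  have hm := (isOpen_hartogsTriangle n k).measurableSet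
  obtain ⟨z, w⟩ := p
  have hz := (mem_hartogsTriangle_iff hk).1 hp
  have hz0 : z ≠ 0 := hz.1.2
  have hz0' : 0 < ‖z‖ := norm_pos_iff.2 hz0
  set σ : ℝ := Real.sqrt (∑ j, ‖w j‖ ^ 2) / ‖z‖ ^ k with hσdef
  have hσ : 0 ≤ σ := by positivity
  have hσ1 : σ < 1 := by
    rw [div_lt_one (by positivity)]
    linarith [hartogs_gap_pos hp]
  -- Every slice is evaluated at the point obtained by rescaling `w`.
  set a : ℂ → Fin n → ℂ := fun x j => x ^ k * (w j / z ^ k) with hadef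
  have ha : ∀ x, ∑ j, ‖a x j‖ ^ 2 ≤ (σ * ‖x‖ ^ k) ^ 2 := by
    intro x
    have h1 : (σ * ‖x‖ ^ k) ^ 2 = (‖x‖ ^ k / ‖z‖ ^ k) ^ 2 * ∑ j, ‖w j‖ ^ 2 := by
      rw [hσdef, div_mul_eq_mul_div, div_pow, mul_pow, Real.sq_sqrt (by positivity), div_pow]
      ring
    rw [h1, Finset.mul_sum]
    refine le_of_eq (Finset.sum_congr rfl fun j _ => ?_)
    rw [hadef]
    simp only [norm_mul, norm_div, norm_pow]
    ring
  have hamem : ∀ x ∈ Metric.ball (0 : ℂ) 1 \ {0}, (x, a x) ∈ hartogsTriangle n k := by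
    intro x hx
    have hx0 : 0 < ‖x‖ := norm_pos_iff.2 hx.2
    refine (mem_hartogsTriangle_iff hk).2 ⟨hx, lt_of_le_of_lt (ha x) ?_⟩
    rw [mul_pow]
    exact mul_lt_of_lt_one_left (by positivity) (pow_lt_one₀ hσ hσ1 two_ne_zero)
  set f : ℂ → ℂ := fun x => x ^ (k * n) * h (x, a x) with hfdef
  have hDm : MeasurableSet (Metric.ball (0 : ℂ) 1 \ {0}) :=
    Metric.isOpen_ball.measurableSet.diff (measurableSet_singleton 0)
  have hfd : DifferentiableOn ℂ f (Metric.ball 0 1 \ {0}) := by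
    refine DifferentiableOn.mul (by fun_prop) (hd.comp (f := fun x => (x, a x)) ?_ hamem)
    refine Differentiable.differentiableOn (differentiable_id.prodMk (differentiable_pi.2 ?_))
    intro j
    simp only [hadef]
    fun_prop
  have hsl : ∀ x ∈ Metric.ball (0 : ℂ) 1 \ {0},
      DifferentiableOn ℂ (fun y => h (x, y)) (sqBall n ((‖x‖ ^ k) ^ 2)) := by
    intro x hx
    refine hd.comp (f := fun y => (x, y)) (by fun_prop) fun y hy => ?_
    exact (mem_hartogsTriangle_iff hk).2 ⟨hx, hy⟩
  have hfin : IsFiniteMeasure (volume.restrict (hartogsTriangle n k)) := by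
    refine ⟨?_⟩
    rw [Measure.restrict_apply_univ]
    refine (measure_mono (t := Metric.ball (0 : ℂ) 1 ×ˢ sqBall n 1) ?_).trans_lt ?_
    · rintro ⟨x, y⟩ hq
      exact ⟨((mem_hartogsTriangle_iff hk).1 hq).1.1, hq.1.trans hq.2⟩
    · rw [Measure.volume_eq_prod, Measure.prod_prod]
      exact ENNReal.mul_lt_top measure_ball_lt_top (volume_sqBall_lt_top _ _)
  obtain ⟨hh, -, -⟩ := fubini_slices hm (hL.integrable one_le_two)
  obtain ⟨hs1, hs2, -⟩ := fubini_slices hm (hL.integrable_norm_pow two_ne_zero)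
  obtain ⟨-, -, hK⟩ := fubini_slices hm
    (MemLp.integrable_mul (memLp_hartogsKernel hk hp) hL)
  -- The factor `x ^ (k * n)` in `f` balances the growth of the point evaluation on a ball of radius
  -- `‖x‖ ^ k`.
  have hfL : MemLp f 2 (volume.restrict (Metric.ball 0 1 \ {0})) := by
    have hfm := hfd.continuousOn.aestronglyMeasurable (μ := volume) hDm
    rw [memLp_two_iff_integrable_sq_norm hfm]
    refine Integrable.mono' ((hs2.integrableOn (s := Metric.ball 0 1 \ {0})).const_mul
      (n ! / (Real.pi ^ n * (1 - σ) ^ (2 * (n + 1))))) (hfm.norm.pow 2) ?_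
    filter_upwards [ae_restrict_of_ae hs1, ae_restrict_of_ae hh, ae_restrict_mem hDm]
      with x hx1 hx2 hx
    have hx0 : 0 < ‖x‖ := norm_pos_iff.2 hx.2
    rw [slice_hartogsTriangle_of_mem hk hx] at hx1 hx2 ⊢
    have := pow_mul_norm_sq_le_of_sqBall hn (by positivity : 0 < ‖x‖ ^ k) hσ hσ1 (ha x) (hsl x hx)
      ((memLp_two_iff_integrable_sq_norm hx2.aestronglyMeasurable).2 hx1)
    rw [norm_pow, norm_norm, hfdef, norm_mul, norm_pow, pow_mul]
    exact this
  have hval : ∀ᵐ x : ℂ, ∫ y in Prod.mk x ⁻¹' hartogsTriangle n k,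
      hartogsKernel n k (z, w) (star (x, y)) * h (x, y) =
      (Metric.ball (0 : ℂ) 1 \ {0}).indicator
        (fun x => ((Real.pi : ℂ) * z ^ (k * n))⁻¹ * (f x / (1 - z * conj x) ^ 2)) x := by
    filter_upwards [hh] with x hx2
    by_cases hx : x ∈ Metric.ball (0 : ℂ) 1 \ {0}
    · rw [slice_hartogsTriangle_of_mem hk hx] at hx2 ⊢
      rw [Set.indicator_of_mem hx]
      have hx0 : x ≠ 0 := hx.2
      have hx0' : 0 < ‖x‖ := norm_pos_iff.2 hx.2
      have hcx0 : conj x ≠ 0 := (map_ne_zero _).2 hx0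
      have h1 := setIntegral_sqBall_kernel hn (by positivity : 0 < ‖x‖ ^ k)
        ((mem_hartogsTriangle_iff hk).1 (hamem x hx)).2 (hsl x hx)
        (integrableOn_sqBall_kernel (by positivity) hσ hσ1 (ha x) hx2)
      have hsq : (((‖x‖ ^ k : ℝ) : ℂ)) ^ 2 = x ^ k * conj x ^ k := by
        rw [← mul_pow, Complex.mul_conj']
        push_cast
        ring
      have hden : ∀ y : Fin n → ℂ, (z * conj x) ^ k - ∑ j, w j * conj (y j) =
          z ^ k / x ^ k * ((((‖x‖ ^ k : ℝ) : ℂ)) ^ 2 - ∑ j, a x j * conj (y j)) := by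
        intro y
        rw [hsq, mul_sub, Finset.mul_sum]
        congr 1
        · rw [mul_pow]
          field_simp
        · refine Finset.sum_congr rfl fun j _ => ?_
          simp only [hadef]
          field_simp
      -- On the slice the kernel is a multiple of the Bergman kernel of the ball at `a x`.
      have hker : ∀ y : Fin n → ℂ, hartogsKernel n k (z, w) (star (x, y)) * h (x, y) =
          (n ! * (z * conj x) ^ k / ((Real.pi : ℂ) ^ (n + 1) * (1 - z * conj x) ^ 2 *
            (z ^ k / x ^ k) ^ (n + 1))) * (h (x, y) /
            ((((‖x‖ ^ k : ℝ) : ℂ)) ^ 2 - ∑ j, a x j * conj (y j)) ^ (n + 1)) := by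
        intro y
        have e : hartogsKernel n k (z, w) (star (x, y)) = (n ! : ℂ) * (z * conj x) ^ k /
            ((Real.pi : ℂ) ^ (n + 1) * (1 - z * conj x) ^ 2 *
            ((z * conj x) ^ k - ∑ j, w j * conj (y j)) ^ (n + 1)) := rfl
        rw [e, hden y, mul_pow (z ^ k / x ^ k), ← mul_assoc, div_mul_div_comm, div_mul_eq_mul_div]
      simp only [hker]
      rw [integral_const_mul, h1, hsq, hfdef]
      have hpi : (Real.pi : ℂ) ≠ 0 := by exact_mod_cast Real.pi_ne_zero
      have hn0 : (n ! : ℂ) ≠ 0 := by exact_mod_cast n.factorial_ne_zero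
      simp only [pow_mul, div_pow, mul_pow z]
      field_simp
      ring
    · rw [Set.indicator_of_notMem hx, slice_hartogsTriangle_of_notMem hk hx]
      simp
  simp only [Pi.mul_apply] at hK
  rw [hK, integral_congr_ae hval, integral_indicator hDm, integral_const_mul,
    setIntegral_punctured_disc_kernel hfd hfL hz.1, hfdef]
  have hpi : (Real.pi : ℂ) ≠ 0 := by exact_mod_cast Real.pi_ne_zero
  have haz : a z = w := by
    ext j
    simp only [hadef]
    field_simp
  simp only [haz]
  field_simp

/-- Cauchy's estimate for the derivative at the centre of a ball. -/
lemma norm_fderiv_le_of_norm_le_ball {E : Type*} [NormedAddCommGroup E] [NormedSpace ℂ E]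
    {f : E → ℂ} {c : E} {R C : ℝ} (hR : 0 < R) (hd : DifferentiableOn ℂ f (Metric.ball c R))
    (hC : ∀ x ∈ Metric.ball c R, ‖f x‖ ≤ C) : ‖fderiv ℂ f c‖ ≤ 2 * C / R := by
  refine Complex.norm_fderiv_le_div_of_mapsTo_ball hd (fun x hx => ?_) hR
  rw [mem_closedBall_iff_norm]
  have h1 := hC x hx
  have h2 := hC c (Metric.mem_ball_self hR)
  linarith [norm_sub_le (f x) (f c)]

/-- The integral operator with the explicit kernel maps `L²` functions to holomorphic functions. -/
lemma differentiableOn_setIntegral_hartogsKernel {n k : ℕ} (hk : 1 ≤ k)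
    {f : ℂ × (Fin n → ℂ) → ℂ} (hf : MemLp f 2 (volume.restrict (hartogsTriangle n k))) :
    DifferentiableOn ℂ (fun p => ∫ q in hartogsTriangle n k, hartogsKernel n k p (star q) * f q)
      (hartogsTriangle n k) := by
  have hop := isOpen_hartogsTriangle n k
  have hm := hop.measurableSet
  have hKd := contDiffOn_hartogsKernel (n := n) hk
  intro p hp
  -- A ball around `p` on which the bound on the kernel is uniform.
  have hBc : ContinuousAt (hartogsBound n k) p := by
    unfold hartogsBound
    have h1 := hartogs_gap_pos hp
    have h2 : 0 < 1 - ‖p.1‖ := sub_pos.2 (norm_lt_one_of_mem hk hp)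
    have hpi := Real.pi_pos
    refine ContinuousAt.div (by fun_prop) (by fun_prop) ?_
    positivity
  have hev : ∀ᶠ p' in nhds p, p' ∈ hartogsTriangle n k ∧
      hartogsBound n k p' < hartogsBound n k p + 1 :=
    (hop.eventually_mem hp).and (hBc.eventually_lt_const (lt_add_one _))
  obtain ⟨ε, hε, hball⟩ := Metric.eventually_nhds_iff_ball.1 hev
  have hsub : ∀ x ∈ Metric.ball p (ε / 2), Metric.ball x (ε / 2) ⊆ Metric.ball p ε := by
    intro x hx
    refine Metric.ball_subset_ball' ?_
    have : dist x p < ε / 2 := hx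
    linarith
  have hdiff : ∀ x ∈ hartogsTriangle n k, ∀ q ∈ hartogsTriangle n k,
      DifferentiableAt ℂ (fun x => hartogsKernel n k x (star q)) x := by
    intro x hx q hq
    have h1 := (hKd.differentiableOn one_ne_zero).comp
      (f := fun x : ℂ × (Fin n → ℂ) => (x, star q)) (s := hartogsTriangle n k)
      (by fun_prop) fun _ hx => ⟨hx, star_mem_hartogsTriangle.2 hq⟩
    exact h1.differentiableAt (hop.mem_nhds hx)
  have hM : ∀ᶠ x in nhds p, AEStronglyMeasurable
      (fun q => hartogsKernel n k x (star q) * f q) (volume.restrict (hartogsTriangle n k)) := by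
    filter_upwards [hop.mem_nhds hp] with x hx
    exact (memLp_hartogsKernel hk hx).1.mul hf.1
  -- Measurability of the derivative in `q`: the polarized kernel is `C¹` jointly in both variables.
  have hF'm : AEStronglyMeasurable
      (fun q => f q • fderiv ℂ (fun x => hartogsKernel n k x (star q)) p)
      (volume.restrict (hartogsTriangle n k)) := by
    refine hf.1.smul (ContinuousOn.aestronglyMeasurable ?_ hm)
    have h1 := hKd.continuousOn_fderiv_of_isOpen (hop.prod hop) le_rfl
    have h2 : ContinuousOn (fun q : ℂ × (Fin n → ℂ) => (fderiv ℂ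
        (fun P : (ℂ × (Fin n → ℂ)) × (ℂ × (Fin n → ℂ)) => hartogsKernel n k P.1 P.2)
        (p, star q)).comp (ContinuousLinearMap.inl ℂ (ℂ × (Fin n → ℂ)) (ℂ × (Fin n → ℂ))))
        (hartogsTriangle n k) := by
      refine ContinuousOn.clm_comp (h1.comp (f := fun q => (p, star q)) ?_ ?_) continuousOn_const
      · exact (continuous_const.prodMk continuous_star).continuousOn
      · exact fun q hq => ⟨hp, star_mem_hartogsTriangle.2 hq⟩
    refine h2.congr fun q hq => ?_
    have h3 : DifferentiableAt ℂ
        (fun P : (ℂ × (Fin n → ℂ)) × (ℂ × (Fin n → ℂ)) => hartogsKernel n k P.1 P.2)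
        (p, star q) := (hKd.differentiableOn one_ne_zero).differentiableAt
      ((hop.prod hop).mem_nhds ⟨hp, star_mem_hartogsTriangle.2 hq⟩)
    exact (h3.hasFDerivAt.comp (f := fun x => (x, star q)) p
      (hasFDerivAt_prodMk_left p (star q))).fderiv
  have hmain := hasFDerivAt_integral_of_dominated_of_fderiv_le (𝕜 := ℂ)
    (μ := volume.restrict (hartogsTriangle n k))
    (F := fun x q => hartogsKernel n k x (star q) * f q)
    (F' := fun x q => f q • fderiv ℂ (fun x => hartogsKernel n k x (star q)) x)
    (bound := fun q => 2 / (ε / 2) * (hartogsBound n k p + 1) *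
      ‖((‖q.1‖ ^ (k * n))⁻¹ : ℝ) * f q‖)
    (Metric.ball_mem_nhds p (half_pos hε)) hM
    (MemLp.integrable_mul (memLp_hartogsKernel hk hp) hf) hF'm ?_ ?_ ?_
  · exact hmain.differentiableAt.differentiableWithinAt
  · refine (ae_restrict_iff' hm).2 (Filter.Eventually.of_forall fun q hq x hx => ?_)
    have h1 := norm_fderiv_le_of_norm_le_ball (half_pos hε)
      (f := fun x => hartogsKernel n k x (star q)) (c := x)
      (C := (hartogsBound n k p + 1) * (‖q.1‖ ^ (k * n))⁻¹)
      (fun x' hx' => (hdiff x' (hball x' (hsub x hx hx')).1 q hq).differentiableWithinAt)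
      fun x' hx' => by
        have h2 := hball x' (hsub x hx hx')
        refine (norm_hartogsKernel_le hk h2.1 (star_mem_hartogsTriangle.2 hq)).trans ?_
        rw [Prod.fst_star, norm_star]
        exact mul_le_mul_of_nonneg_right h2.2.le (by positivity)
    rw [norm_smul, norm_mul, Complex.norm_real, Real.norm_of_nonneg (by positivity)]
    calc _ ≤ ‖f q‖ * _ := mul_le_mul_of_nonneg_left h1 (norm_nonneg _)
      _ = _ := by ring
  · exact (MemLp.integrable_mul (memLp_inv_norm_pow hk).ofReal hf).norm.const_mul _
  · refine (ae_restrict_iff' hm).2 (Filter.Eventually.of_forall fun q hq x hx => ?_)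
    have h1 : x ∈ hartogsTriangle n k :=
      (hball x (Metric.ball_subset_ball (by linarith) hx)).1
    exact (hdiff x h1 q hq).hasFDerivAt.mul_const (f q)

/-- The integral operator at a point is the inner product with an `L²` function, so it is continuous
in `f` and vanishes on the orthogonal complement of the Bergman space. -/
lemma inner_toLp_hartogsKernel {n k : ℕ} (hk : 1 ≤ k) {p : ℂ × (Fin n → ℂ)}
    (hp : p ∈ hartogsTriangle n k) (f : Lp ℂ 2 (volume.restrict (hartogsTriangle n k))) :
    inner ℂ ((memLp_hartogsKernel hk hp).star.toLp _) f =
      ∫ q in hartogsTriangle n k, hartogsKernel n k p (star q) * f q := by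
  rw [L2.inner_def]
  refine integral_congr_ae ?_
  filter_upwards [(memLp_hartogsKernel hk hp).star.coeFn_toLp] with q hq
  rw [hq]
  simp [mul_comm]

lemma setIntegral_hartogsKernel_mul_of_mem {n k : ℕ} (hn : 1 ≤ n) (hk : 1 ≤ k)
    {f : Lp ℂ 2 (volume.restrict (hartogsTriangle n k))}
    (hf : f ∈ bergmanSpace (hartogsTriangle n k)) :
    f =ᵐ[volume.restrict (hartogsTriangle n k)]
      fun p => ∫ q in hartogsTriangle n k, hartogsKernel n k p (star q) * f q := by
  obtain ⟨g, hg, hfg⟩ := hf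
  have hm := (isOpen_hartogsTriangle n k).measurableSet
  filter_upwards [hfg, ae_restrict_mem hm] with p hp hpm
  rw [hp, ← setIntegral_hartogsKernel_mul hn hk hpm hg ((memLp_congr_ae hfg).1 (Lp.memLp f))]
  refine integral_congr_ae ?_
  filter_upwards [hfg] with q hq
  rw [hq]

/-- The Bergman space is closed: a limit in `L²` is almost everywhere the limit of a subsequence,
and by the reproducing property this pointwise limit is the image of the `L²` limit under the
integral operator, which is holomorphic. -/
lemma isClosed_bergmanSpace_hartogsTriangle {n k : ℕ} (hn : 1 ≤ n) (hk : 1 ≤ k) :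
    IsClosed (bergmanSpace (hartogsTriangle n k) :
      Set (Lp ℂ 2 (volume.restrict (hartogsTriangle n k)))) := by
  have hm := (isOpen_hartogsTriangle n k).measurableSet
  refine IsSeqClosed.isClosed fun u f hu hlim => ?_
  obtain ⟨ns, hns, hae⟩ := (tendstoInMeasure_of_tendsto_Lp hlim).exists_seq_tendsto_ae
  refine ⟨_, differentiableOn_setIntegral_hartogsKernel hk (Lp.memLp f), ?_⟩
  have h1 : ∀ᵐ p ∂(volume.restrict (hartogsTriangle n k)), ∀ i, u i p =
      ∫ q in hartogsTriangle n k, hartogsKernel n k p (star q) * u i q :=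
    ae_all_iff.2 fun i => setIntegral_hartogsKernel_mul_of_mem hn hk (hu i)
  filter_upwards [h1, hae, ae_restrict_mem hm] with p hp1 hp2 hp
  refine tendsto_nhds_unique hp2 ?_
  simp only [hp1, ← inner_toLp_hartogsKernel hk hp]
  exact (tendsto_const_nhds.inner hlim).comp hns.tendsto_atTop

lemma isBergmanKernel_hartogsKernel {n k : ℕ} (hn : 1 ≤ n) (hk : 1 ≤ k) :
    IsBergmanKernel (hartogsTriangle n k) fun p q => hartogsKernel n k p (star q) where
  differentiableOn_conj p hp := by
    simp only [conj_hartogsKernel, star_star]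
    exact differentiableOn_hartogsKernel_right hk (star_mem_hartogsTriangle.2 hp)
  memLp p hp := memLp_hartogsKernel hk hp
  projection f := by
    have hm := (isOpen_hartogsTriangle n k).measurableSet
    refine ⟨differentiableOn_setIntegral_hartogsKernel hk (Lp.memLp f), ?_⟩
    have hcomp : CompleteSpace (bergmanSpace (hartogsTriangle n k)) :=
      (isClosed_bergmanSpace_hartogsTriangle hn hk).completeSpace_coe
    set g' := (bergmanSpace (hartogsTriangle n k)).starProjection f
    have hg' : g' ∈ bergmanSpace (hartogsTriangle n k) :=
      Submodule.starProjection_apply_mem _ f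
    have horth : f - g' ∈ (bergmanSpace (hartogsTriangle n k))ᗮ :=
      Submodule.sub_starProjection_mem_orthogonal f
    refine ⟨g', hg', ?_, horth⟩
    filter_upwards [setIntegral_hartogsKernel_mul_of_mem hn hk hg', ae_restrict_mem hm]
      with p hp1 hp
    have hKmem : (memLp_hartogsKernel hk hp).star.toLp _ ∈ bergmanSpace (hartogsTriangle n k) :=
      ⟨fun q => conj (hartogsKernel n k p (star q)), by
        simp only [conj_hartogsKernel, star_star]
        exact differentiableOn_hartogsKernel_right hk (star_mem_hartogsTriangle.2 hp),
        (memLp_hartogsKernel hk hp).star.coeFn_toLp⟩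
    have h0 := (Submodule.mem_orthogonal _ _).1 horth _ hKmem
    rw [inner_sub_right, sub_eq_zero] at h0
    rw [hp1, ← inner_toLp_hartogsKernel hk hp, ← inner_toLp_hartogsKernel hk hp, h0]

/-! ### Uniqueness of Bergman kernels -/

section Uniqueness

variable {E : Type*} [NormedAddCommGroup E] [NormedSpace ℂ E] [MeasureSpace E]

lemma IsBergmanProjection.eqOn [OpensMeasurableSpace E] [(volume : Measure E).IsOpenPosMeasure]
    {Ω : Set E} (hΩ : IsOpen Ω)
    {f : Lp ℂ 2 (volume.restrict Ω)} {g₁ g₂ : E → ℂ} (h₁ : IsBergmanProjection Ω f g₁)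
    (h₂ : IsBergmanProjection Ω f g₂) : Set.EqOn g₁ g₂ Ω := by
  obtain ⟨hd₁, p₁, hp₁, he₁, ho₁⟩ := h₁
  obtain ⟨hd₂, p₂, hp₂, he₂, ho₂⟩ := h₂
  have h0 : p₁ - p₂ = 0 := by
    have h1 : p₁ - p₂ ∈ (bergmanSpace Ω)ᗮ := by
      have := Submodule.sub_mem _ ho₂ ho₁
      rwa [sub_sub_sub_cancel_left] at this
    exact inner_self_eq_zero.1
      ((Submodule.mem_orthogonal _ _).1 h1 _ (Submodule.sub_mem _ hp₁ hp₂))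
  rw [sub_eq_zero] at h0
  subst h0
  exact Measure.eqOn_open_of_ae_eq (he₁.symm.trans he₂) hΩ hd₁.continuousOn hd₂.continuousOn

lemma IsBergmanKernel.continuousOn {Ω : Set E} {K : E → E → ℂ} (hK : IsBergmanKernel Ω K) {p : E}
    (hp : p ∈ Ω) : ContinuousOn (K p) Ω := by
  have h := (Complex.continuous_conj.comp_continuousOn (hK.differentiableOn_conj p hp).continuousOn)
  simpa [Function.comp_def] using h

/-- Uniqueness of the Bergman kernel: the difference of two kernels at `p` is tested against its own
complex conjugate. -/
lemma IsBergmanKernel.eqOn [OpensMeasurableSpace E] [(volume : Measure E).IsOpenPosMeasure]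
    {Ω : Set E} (hΩ : IsOpen Ω) {K₁ K₂ : E → E → ℂ}
    (h₁ : IsBergmanKernel Ω K₁) (h₂ : IsBergmanKernel Ω K₂) {p : E} (hp : p ∈ Ω) :
    Set.EqOn (K₁ p) (K₂ p) Ω := by
  have hL := (h₁.memLp p hp).sub (h₂.memLp p hp)
  set f := hL.star.toLp _
  have hint : ∀ K, IsBergmanKernel Ω K → Integrable (fun q => K p q * f q) (volume.restrict Ω) :=
    fun K hK => MemLp.integrable_mul (hK.memLp p hp) (Lp.memLp f)
  have h0 : ∫ q in Ω, ‖K₁ p q - K₂ p q‖ ^ 2 = 0 := by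
    have h1 := (h₁.projection f).eqOn hΩ (h₂.projection f) hp
    simp only at h1
    rw [← sub_eq_zero, ← integral_sub (hint _ h₁) (hint _ h₂)] at h1
    have h2 : ∫ q in Ω, (K₁ p q * f q - K₂ p q * f q) =
        ∫ q in Ω, ((‖K₁ p q - K₂ p q‖ ^ 2 : ℝ) : ℂ) := by
      refine integral_congr_ae ?_
      filter_upwards [hL.star.coeFn_toLp] with q hq
      rw [← sub_mul, hq, Pi.star_apply, Pi.sub_apply, RCLike.star_def, Complex.mul_conj']
      push_cast
      rfl
    rw [h2, integral_complex_ofReal] at h1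
    exact_mod_cast h1
  have h3 := (integral_eq_zero_iff_of_nonneg (fun q => by positivity)
    (hL.integrable_norm_pow two_ne_zero)).1 h0
  refine Measure.eqOn_open_of_ae_eq (μ := volume) ?_ hΩ (h₁.continuousOn hp) (h₂.continuousOn hp)
  filter_upwards [h3] with q hq
  simpa [sub_eq_zero] using hq

lemma IsBergmanKernel.congr {Ω : Set E} (hΩ : MeasurableSet Ω) {K₁ K₂ : E → E → ℂ}
    (h₁ : IsBergmanKernel Ω K₁) (h : ∀ p ∈ Ω, Set.EqOn (K₁ p) (K₂ p) Ω) :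
    IsBergmanKernel Ω K₂ where
  differentiableOn_conj p hp :=
    (h₁.differentiableOn_conj p hp).congr fun q hq => by rw [h p hp hq]
  memLp p hp := by
    refine (memLp_congr_ae ?_).1 (h₁.memLp p hp)
    exact (ae_restrict_iff' hΩ).2 (Filter.Eventually.of_forall (h p hp))
  projection f := by
    have hI : Set.EqOn (fun p => ∫ q in Ω, K₁ p q * f q) (fun p => ∫ q in Ω, K₂ p q * f q) Ω :=
      fun p hp => setIntegral_congr_fun hΩ fun q hq => by simp only [h p hp hq]
    obtain ⟨hd, g, hg, he, ho⟩ := h₁.projection f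
    exact ⟨hd.congr fun p hp => (hI hp).symm, g, hg,
      he.trans ((ae_restrict_iff' hΩ).2 (Filter.Eventually.of_forall hI)), ho⟩

end Uniqueness

/-! ### The explicit formula characterizes the Bergman kernel -/

theorem mainTheorem2 (n k : ℕ) (hn : 1 ≤ n) (hk : 1 ≤ k)
    (K : ℂ × (Fin n → ℂ) → ℂ × (Fin n → ℂ) → ℂ) :
    IsBergmanKernel (hartogsTriangle n k) K ↔
      ∀ (z : ℂ) (w : Fin n → ℂ) (x : ℂ) (y : Fin n → ℂ),
        (z, w) ∈ hartogsTriangle n k → (x, y) ∈ hartogsTriangle n k →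
          K (z, w) (x, y) =
            (n ! : ℂ) * (z * conj x) ^ k /
              ((Real.pi : ℂ) ^ (n + 1) * (1 - z * conj x) ^ 2 *
                ((z * conj x) ^ k - ∑ j, w j * conj (y j)) ^ (n + 1)) := by
  have hop := isOpen_hartogsTriangle n k
  have hK₀ := isBergmanKernel_hartogsKernel hn hk
  constructor
  · intro hK z w x y hp hq
    exact hK.eqOn hop hK₀ hp hq
  · intro hK
    refine hK₀.congr hop.measurableSet ?_
    rintro ⟨z, w⟩ hp ⟨x, y⟩ hq
    exact (hK z w x y hp hq).symm
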